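/- Let $(X,\mathcal O_X)$ be a commutative ringed space. A quiver $Q=(Q_0,Q_1,h,t)$ consists of finite sets $Q_0$ of vertices and $Q_1$ of edges and maps $h,t:Q_1\to Q_0$ (head and tail). For a family $M=(M_\alpha)_{\alpha\in Q_1}$ of $\mathcal O_X$-modules put $\mathcal B=\bigoplus_{i\in Q_0}\mathcal O_X e_i$ with $e_ie_j=\delta_{ij}e_i$, and regard $\bigoplus_\alpha M_\alpha$ as a $\mathcal B$-bimodule by $e_{h\alpha}m=m=m\,e_{t\alpha}$ for $m\in M_\alpha$ (all other products $e_im$, $me_i$ being $0$). The twisted path algebra $\mathcal T_M\mathcal A_Q$ is the sheaf of $\mathcal O_X$-algebras given by the tensor algebra of this bimodule over $\mathcal B$. For a path $p=\alpha_1\cdots\alpha_k$ (so $t\alpha_n=h\alpha_{n+1}$ for $1\le n<k$), of length $k\ge 1$, put $M_p=M_{\alpha_1}\otimes_{\mathcal O_X}\cdots\otimes_{\mathcal O_X}M_{\alpha_k}$, which maps to $\mathcal T_M\mathcal A_Q$ by multiplication. A relation in $Q$ is a finite sum $\sum_p m_p$ with $m_p\in M_p(X)$ over paths $p$ of length at least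 $2$ with a common tail and a common head. Let $Q',Q''$ be quivers and $M'=(M'_\alpha)_{\alpha\in Q'_1}$, $M''=(M''_\beta)_{\beta\in Q''_1}$ families of $\mathcal O_X$-modules. The tensor quiver $Q'\otimes Q''$ has vertex set $Q'_0\times Q''_0$ and edge set $(Q'_1\times Q''_0)\sqcup(Q'_0\times Q''_1)$, with $h(\alpha,j)=(h\alpha,j)$, $t(\alpha,j)=(t\alpha,j)$, $h(i,\beta)=(i,h\beta)$, $t(i,\beta)=(i,t\beta)$; it is twisted by the family $M$ with $M_{(\alpha,j)}=M'_\alpha$ and $M_{(i,\beta)}=M''_\beta$. For a section $m$ of $M'_\alpha$ (resp. $M''_\beta$) write $m_{(\alpha,j)}$ (resp. $m_{(i,\beta)}$) for $m$ viewed as a section of $M_{(\alpha,j)}$ (resp. $M_{(i,\beta)}$). For a relation $r'=\sum_p m_p$ in $Q'$ and $j\in Q''_0$ let $m_{(r',j)}$ be the same sum with each $m_p$ viewed as a section of $M_{(p,j)}=M'_p$; define $m_{(i,r'')}$ analogously for a relation $r''$ in $Q''$ and $i\in Q'_0$. Let $\mathcal I$ be the two-sided ideal sheaf of $\mathcal T_M\mathcal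 A_{Q'\otimes Q''}$ generated, over all open $U\subseteq X$, by the differences $$m''_{(h\alpha,\beta)}\otimes m'_{(\alpha,t\beta)}-m'_{(\alpha,h\beta)}\otimes m''_{(t\alpha,\beta)},\qquad \alpha\in Q'_1,\ \beta\in Q''_1,\ m'\in M'_\alpha(U),\ m''\in M''_\beta(U).$$ (a) There is an isomorphism of sheaves of $\mathcal O_X$-algebras $$\mathcal T_M\mathcal A_{Q'\otimes Q''}/\mathcal I\;\cong\;\mathcal T_{M'}\mathcal A_{Q'}\otimes_{\mathcal O_X}\mathcal T_{M''}\mathcal A_{Q''}.$$ (b) More generally, let $\mathcal R'$, $\mathcal R''$ be sets of relations in $Q'$, $Q''$, generating the two-sided ideal sheaves $\mathcal J'\subseteq\mathcal T_{M'}\mathcal A_{Q'}$ and $\mathcal J''\subseteq\mathcal T_{M''}\mathcal A_{Q''}$, and let $\mathcal I'$, $\mathcal I''$ be the two-sided ideal sheaves of $\mathcal T_M\mathcal A_{Q'\otimes Q''}$ generated by the sums $\sum_{j\in Q''_0}m_{(r',j)}$, $r'\in\mathcal R'$, and $\sum_{i\in Q'_0}m_{(i,r'')}$, $r''\in\mathcal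 R''$, respectively. Then there is an isomorphism of sheaves of $\mathcal O_X$-algebras $$\mathcal T_M\mathcal A_{Q'\otimes Q''}/(\mathcal I+\mathcal I'+\mathcal I'')\;\cong\;\mathcal T_{M'}\mathcal A_{Q'}/\mathcal J'\otimes_{\mathcal O_X}\mathcal T_{M''}\mathcal A_{Q''}/\mathcal J''.$$ -/

import Mathlib

open CategoryTheory Opposite TopologicalSpace AlgebraicGeometry
open scoped TensorProduct

universe u

noncomputable section

namespace TwistedPathAlgebra

/-- A quiver: finite sets of vertices and edges, with head and tail maps. -/
structure FinQuiver where
  /-- vertices -/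
  V : Type u
  /-- edges -/
  E : Type u
  [fintypeV : Fintype V]
  [fintypeE : Fintype E]
  /-- the head of an edge -/
  h : E → V
  /-- the tail of an edge -/
  t : E → V

attribute [instance] FinQuiver.fintypeV FinQuiver.fintypeE

/-- The tensor quiver `Q' ⊗ Q''`. -/
def FinQuiver.tensor (Q' Q'' : FinQuiver.{u}) : FinQuiver.{u} where
  V := Q'.V × Q''.V
  E := (Q'.E × Q''.V) ⊕ (Q'.V × Q''.E)
  h := Sum.elim (fun a => (Q'.h a.1, a.2)) (fun b => (b.1, Q''.h b.2))
  t := Sum.elim (fun a => (Q'.t a.1, a.2)) (fun b => (b.1, Q''.t b.2))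

/-- A non-trivial path `α₁ α₂ ⋯ αₖ`, `k ≥ 1`, with `t αₙ = h αₙ₊₁`. -/
structure FinQuiver.Path (Q : FinQuiver.{u}) where
  /-- the length of the path -/
  length : ℕ
  pos : 0 < length
  /-- the sequence of edges -/
  edge : Fin length → Q.E
  comp : ∀ (k : ℕ) (hk : k + 1 < length),
    Q.t (edge ⟨k, Nat.lt_of_succ_lt hk⟩) = Q.h (edge ⟨k + 1, hk⟩)

/-- The head of a path is the head of its first edge. -/
def FinQuiver.Path.head {Q : FinQuiver.{u}} (p : Q.Path) : Q.V :=
  Q.h (p.edge ⟨0, p.pos⟩)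

/-- The tail of a path is the tail of its last edge. -/
def FinQuiver.Path.tail {Q : FinQuiver.{u}} (p : Q.Path) : Q.V :=
  Q.t (p.edge ⟨p.length - 1, Nat.sub_lt p.pos Nat.one_pos⟩)

/-- The path `(p, j)` of `Q' ⊗ Q''`, for a path `p` of `Q'` and a vertex `j` of `Q''`. -/
def FinQuiver.Path.left {Q' : FinQuiver.{u}} (Q'' : FinQuiver.{u}) (p : Q'.Path) (j : Q''.V) :
    (Q'.tensor Q'').Path where
  length := p.length
  pos := p.pos
  edge k := Sum.inl (p.edge k, j)
  comp k hk := Prod.ext (p.comp k hk) rfl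

/-- The path `(i, q)` of `Q' ⊗ Q''`, for a vertex `i` of `Q'` and a path `q` of `Q''`. -/
def FinQuiver.Path.right (Q' : FinQuiver.{u}) {Q'' : FinQuiver.{u}} (i : Q'.V) (q : Q''.Path) :
    (Q'.tensor Q'').Path where
  length := q.length
  pos := q.pos
  edge k := Sum.inr (i, q.edge k)
  comp k hk := Prod.ext rfl (q.comp k hk)

/-! ### The twisted path algebra over a commutative ring -/

section Ring

variable (R : Type u) [CommRing R] (Q : FinQuiver.{u}) (M : Q.E → Type u)
  [∀ a, AddCommGroup (M a)] [∀ a, Module R (M a)]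

/-- The relations which make the `R`-linear tensor algebra of `B ⊕ M` into the tensor algebra
of the `B`-bimodule `M` over `B`. Here `B = ⨁ᵢ R eᵢ` is realised as the product ring `Q.V → R`
(with `eᵢ` the `i`-th unit vector), and the finite direct sum `M = ⨁ₐ Mₐ` as a product. -/
inductive TensorRel :
    TensorAlgebra R ((Q.V → R) × ((a : Q.E) → M a)) →
      TensorAlgebra R ((Q.V → R) × ((a : Q.E) → M a)) → Prop
  | one : TensorRel (TensorAlgebra.ι R (1, 0)) 1
  | mul (b c : Q.V → R) :
      TensorRel (TensorAlgebra.ι R (b, 0) * TensorAlgebra.ι R (c, 0)) (TensorAlgebra.ι R (b * c, 0))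
  | left (b : Q.V → R) (m : (a : Q.E) → M a) :
      TensorRel (TensorAlgebra.ι R (b, 0) * TensorAlgebra.ι R (0, m))
        (TensorAlgebra.ι R (0, fun a => b (Q.h a) • m a))
  | right (m : (a : Q.E) → M a) (b : Q.V → R) :
      TensorRel (TensorAlgebra.ι R (0, m) * TensorAlgebra.ι R (b, 0))
        (TensorAlgebra.ι R (0, fun a => b (Q.t a) • m a))

/-- The `M`-twisted path algebra of `Q` over `R`: the tensor algebra of the bimodule
`M = ⨁ₐ Mₐ` over `B = ⨁ᵢ R eᵢ`. -/
def PathAlg : Type u := RingQuot (TensorRel R Q M)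

instance : Ring (PathAlg R Q M) := inferInstanceAs (Ring (RingQuot (TensorRel R Q M)))

instance : Algebra R (PathAlg R Q M) :=
  inferInstanceAs (Algebra R (RingQuot (TensorRel R Q M)))

/-- The canonical map `B ⊕ M → T_B(M)`. -/
def PathAlg.gen : (Q.V → R) × ((a : Q.E) → M a) →ₗ[R] PathAlg R Q M :=
  (RingQuot.mkAlgHom R (TensorRel R Q M)).toLinearMap ∘ₗ TensorAlgebra.ι R

open Classical in
/-- The canonical map `Mₐ → T_B(M)` for an edge `a`. -/
def PathAlg.arrow (a : Q.E) : M a →ₗ[R] PathAlg R Q M :=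
  PathAlg.gen R Q M ∘ₗ LinearMap.inr R (Q.V → R) ((a : Q.E) → M a) ∘ₗ LinearMap.single R M a

variable {R Q M}

lemma PathAlg.gen_one : PathAlg.gen R Q M (1, 0) = 1 :=
  (RingQuot.mkAlgHom_rel R TensorRel.one).trans (map_one _)

lemma PathAlg.gen_mul (b c : Q.V → R) :
    PathAlg.gen R Q M (b, 0) * PathAlg.gen R Q M (c, 0) = PathAlg.gen R Q M (b * c, 0) :=
  ((RingQuot.mkAlgHom R (TensorRel R Q M)).map_mul _ _).symm.trans
    (RingQuot.mkAlgHom_rel R (TensorRel.mul b c))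

lemma PathAlg.gen_left (b : Q.V → R) (m : (a : Q.E) → M a) :
    PathAlg.gen R Q M (b, 0) * PathAlg.gen R Q M (0, m) =
      PathAlg.gen R Q M (0, fun a => b (Q.h a) • m a) :=
  ((RingQuot.mkAlgHom R (TensorRel R Q M)).map_mul _ _).symm.trans
    (RingQuot.mkAlgHom_rel R (TensorRel.left b m))

lemma PathAlg.gen_right (m : (a : Q.E) → M a) (b : Q.V → R) :
    PathAlg.gen R Q M (0, m) * PathAlg.gen R Q M (b, 0) =
      PathAlg.gen R Q M (0, fun a => b (Q.t a) • m a) :=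
  ((RingQuot.mkAlgHom R (TensorRel R Q M)).map_mul _ _).symm.trans
    (RingQuot.mkAlgHom_rel R (TensorRel.right m b))

/-- The universal property of the tensor algebra of the bimodule `M` over `B`. -/
def PathAlg.lift {A : Type u} [Ring A] [Algebra R A]
    (g : (Q.V → R) × ((a : Q.E) → M a) →ₗ[R] A) (h1 : g (1, 0) = 1)
    (hm : ∀ b c : Q.V → R, g (b, 0) * g (c, 0) = g (b * c, 0))
    (hl : ∀ (b : Q.V → R) (m : (a : Q.E) → M a),
      g (b, 0) * g (0, m) = g (0, fun a => b (Q.h a) • m a))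
    (hr : ∀ (m : (a : Q.E) → M a) (b : Q.V → R),
      g (0, m) * g (b, 0) = g (0, fun a => b (Q.t a) • m a)) :
    PathAlg R Q M →ₐ[R] A :=
  RingQuot.liftAlgHom R ⟨TensorAlgebra.lift R g, by
    rintro _ _ (_ | ⟨b, c⟩ | ⟨b, m⟩ | ⟨m, b⟩)
    · simp [h1]
    · simp [hm]
    · simp [hl]
    · simp [hr]⟩

lemma PathAlg.lift_gen {A : Type u} [Ring A] [Algebra R A]
    (g : (Q.V → R) × ((a : Q.E) → M a) →ₗ[R] A) (h1 hm hl hr) (x) :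
    PathAlg.lift g h1 hm hl hr (PathAlg.gen R Q M x) = g x :=
  (RingQuot.liftAlgHom_mkAlgHom_apply R _ _ _).trans (TensorAlgebra.lift_ι_apply g x)

lemma PathAlg.ringHom_ext {A : Type u} [Ring A] {f g : PathAlg R Q M →+* A}
    (h : ∀ x, f (PathAlg.gen R Q M x) = g (PathAlg.gen R Q M x)) : f = g := by
  have hR : ∀ r : R, f (algebraMap R _ r) = g (algebraMap R _ r) := by
    intro r
    rw [Algebra.algebraMap_eq_smul_one, ← PathAlg.gen_one, ← map_smul]
    exact h _
  suffices H : ∀ x : TensorAlgebra R ((Q.V → R) × ((a : Q.E) → M a)),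
      f (RingQuot.mkAlgHom R (TensorRel R Q M) x) = g (RingQuot.mkAlgHom R (TensorRel R Q M) x) by
    ext x
    obtain ⟨y, rfl⟩ := RingQuot.mkAlgHom_surjective R (TensorRel R Q M) x
    exact H y
  intro x
  induction x using TensorAlgebra.induction with
  | algebraMap r => rw [AlgHom.commutes]; exact hR r
  | ι x => exact h x
  | mul a b ha hb => rw [map_mul]; erw [map_mul, map_mul]; rw [ha, hb]
  | add a b ha hb => rw [map_add]; erw [map_add, map_add]; rw [ha, hb]

section Map

variable {S : Type u} [CommRing S] {N : Q.E → Type u}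
  [∀ a, AddCommGroup (N a)] [∀ a, Module S (N a)]

/-- Functoriality of the twisted path algebra in the ring and the modules. -/
def PathAlg.map (ρ : R →+* S) (f : ∀ a, M a →ₛₗ[ρ] N a) : PathAlg R Q M →+* PathAlg S Q N :=
  letI : Algebra R (PathAlg S Q N) :=
    ((algebraMap S (PathAlg S Q N)).comp ρ).toAlgebra' fun r x => Algebra.commutes (ρ r) x
  (PathAlg.lift (A := PathAlg S Q N)
    { toFun := fun x => PathAlg.gen S Q N (fun i => ρ (x.1 i), fun a => f a (x.2 a))
      map_add' := fun x y => by
        rw [← map_add]; congr 1; ext <;> simp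
      map_smul' := fun r x => by
        rw [Algebra.smul_def]
        change _ = algebraMap S (PathAlg S Q N) (ρ r) * _
        rw [← Algebra.smul_def, ← map_smul]; congr 1; ext <;> simp }
    (by
      change PathAlg.gen S Q N _ = _
      rw [← PathAlg.gen_one]; congr 1; ext <;> simp)
    (fun b c => by
      change PathAlg.gen S Q N _ * PathAlg.gen S Q N _ = PathAlg.gen S Q N _
      convert PathAlg.gen_mul (M := N) (fun i => ρ (b i)) (fun i => ρ (c i)) using 2
      · congr 1; ext <;> simp
      · congr 1; ext <;> simp
      · ext <;> simp)
    (fun b m => by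
      change PathAlg.gen S Q N _ * PathAlg.gen S Q N _ = PathAlg.gen S Q N _
      convert PathAlg.gen_left (M := N) (fun i => ρ (b i)) (fun a => f a (m a)) using 2
      · congr 1; ext <;> simp
      · congr 1; ext <;> simp
      · ext <;> simp)
    (fun m b => by
      change PathAlg.gen S Q N _ * PathAlg.gen S Q N _ = PathAlg.gen S Q N _
      convert PathAlg.gen_right (M := N) (fun a => f a (m a)) (fun i => ρ (b i)) using 2
      · congr 1; ext <;> simp
      · congr 1; ext <;> simp
      · ext <;> simp)).toRingHom

lemma PathAlg.map_gen (ρ : R →+* S) (f : ∀ a, M a →ₛₗ[ρ] N a)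
    (x : (Q.V → R) × ((a : Q.E) → M a)) :
    PathAlg.map ρ f (PathAlg.gen R Q M x) =
      PathAlg.gen S Q N (fun i => ρ (x.1 i), fun a => f a (x.2 a)) := by
  let : Algebra R (PathAlg S Q N) :=
    ((algebraMap S (PathAlg S Q N)).comp ρ).toAlgebra' fun r x => Algebra.commutes (ρ r) x
  exact PathAlg.lift_gen (A := PathAlg S Q N) _ _ _ _ _ x

lemma PathAlg.map_algebraMap (ρ : R →+* S) (f : ∀ a, M a →ₛₗ[ρ] N a) (r : R) :
    PathAlg.map ρ f (algebraMap R _ r) = algebraMap S _ (ρ r) := by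
  let : Algebra R (PathAlg S Q N) :=
    ((algebraMap S (PathAlg S Q N)).comp ρ).toAlgebra' fun r x => Algebra.commutes (ρ r) x
  exact AlgHom.commutes _ r

lemma PathAlg.map_arrow (ρ : R →+* S) (f : ∀ a, M a →ₛₗ[ρ] N a) (a : Q.E) (m : M a) :
    PathAlg.map ρ f (PathAlg.arrow R Q M a m) = PathAlg.arrow S Q N a (f a m) := by
  classical
  simp only [PathAlg.arrow, LinearMap.comp_apply, PathAlg.map_gen]
  congr 1
  ext c
  · simp
  · by_cases h : c = a
    · subst h; simp
    · simp [Pi.single_eq_of_ne h]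

end Map

variable (R Q M) in
/-- The map `M_{a₁} ⊗ ⋯ ⊗ M_{aₙ} → T_B(M)` given by multiplication. -/
def PathAlg.tensorMap {n : ℕ} (a : Fin n → Q.E) : (⨂[R] k, M (a k)) →ₗ[R] PathAlg R Q M :=
  PiTensorProduct.lift ((MultilinearMap.mkPiAlgebraFin R n (PathAlg R Q M)).compLinearMap
    fun k => PathAlg.arrow R Q M (a k))

lemma PathAlg.map_tensorMap {S : Type u} [CommRing S] {N : Q.E → Type u}
    [∀ a, AddCommGroup (N a)] [∀ a, Module S (N a)] (ρ : R →+* S) (f : ∀ a, M a →ₛₗ[ρ] N a)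
    {n : ℕ} (a : Fin n → Q.E) (r : R) (m : ∀ k, M (a k)) :
    PathAlg.map ρ f (PathAlg.tensorMap R Q M a (r • PiTensorProduct.tprod R m)) =
      PathAlg.tensorMap S Q N a (ρ r • PiTensorProduct.tprod S fun k => f (a k) (m k)) := by
  rw [LinearMap.map_smul, LinearMap.map_smul, Algebra.smul_def, Algebra.smul_def,
    RingHom.map_mul, PathAlg.map_algebraMap]
  congr 1
  simp only [PathAlg.tensorMap, PiTensorProduct.lift.tprod, MultilinearMap.compLinearMap_apply,
    MultilinearMap.mkPiAlgebraFin_apply, map_list_prod, List.map_ofFn]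
  congr 2
  ext k
  exact PathAlg.map_arrow ρ f (a k) (m k)

end Ring

/-- Functoriality of the tensor product of a family of modules in the ring and the modules. -/
def piTensorMap {R S : Type u} [CommRing R] [CommRing S] (ρ : R →+* S) {n : ℕ}
    {M N : Fin n → Type u} [∀ k, AddCommGroup (M k)] [∀ k, Module R (M k)]
    [∀ k, AddCommGroup (N k)] [∀ k, Module S (N k)] (f : ∀ k, M k →ₛₗ[ρ] N k) :
    (⨂[R] k, M k) →+ (⨂[S] k, N k) :=
  letI : Module R (⨂[S] k, N k) := Module.compHom _ ρ
  (PiTensorProduct.lift (R := R) (E := ⨂[S] k, N k)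
    { toFun := fun m => PiTensorProduct.tprod S fun k => f k (m k)
      map_update_add' := fun m k x y => by
        have H : ∀ z, (fun l => f l (Function.update m k z l)) =
            Function.update (fun l => f l (m l)) k (f k z) := fun z => by
          ext l
          by_cases h : l = k
          · subst h; simp
          · simp [h]
        simp only [H, map_add, MultilinearMap.map_update_add]
      map_update_smul' := fun m k r x => by
        have H : ∀ z, (fun l => f l (Function.update m k z l)) =
            Function.update (fun l => f l (m l)) k (f k z) := fun z => by
          ext l
          by_cases h : l = k
          · subst h; simp
          · simp [h]
        simp only [H, LinearMap.map_smulₛₗ, MultilinearMap.map_update_smul]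
        rfl }).toAddMonoidHom

lemma piTensorMap_smul_tprod {R S : Type u} [CommRing R] [CommRing S] (ρ : R →+* S) {n : ℕ}
    {M N : Fin n → Type u} [∀ k, AddCommGroup (M k)] [∀ k, Module R (M k)]
    [∀ k, AddCommGroup (N k)] [∀ k, Module S (N k)] (f : ∀ k, M k →ₛₗ[ρ] N k)
    (r : R) (m : ∀ k, M k) :
    piTensorMap ρ f (r • PiTensorProduct.tprod R m) =
      ρ r • PiTensorProduct.tprod S fun k => f k (m k) := by
  let : Module R (⨂[S] k, N k) := Module.compHom _ ρ
  unfold piTensorMap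
  rw [LinearMap.toAddMonoidHom_coe, LinearMap.map_smul, PiTensorProduct.lift.tprod]
  rfl

lemma piTensor_addHom_ext {R : Type u} [CommRing R] {n : ℕ}
    {M : Fin n → Type u} [∀ k, AddCommGroup (M k)] [∀ k, Module R (M k)]
    {A : Type u} [AddCommGroup A] {f g : (⨂[R] k, M k) →+ A}
    (h : ∀ (r : R) (m : ∀ k, M k), f (r • PiTensorProduct.tprod R m) =
      g (r • PiTensorProduct.tprod R m)) : f = g := by
  ext x
  induction x using PiTensorProduct.induction_on with
  | smul_tprod r m => exact h r m
  | add x y hx hy => rw [map_add, map_add, hx, hy]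

/-- Functoriality of the tensor product of two (not necessarily commutative) algebras in the
base ring and the algebras. -/
def tensorMap {R S : Type u} [CommRing R] [CommRing S] {A B A' B' : Type u} [Ring A] [Ring B]
    [Ring A'] [Ring B'] [Algebra R A] [Algebra R B] [Algebra S A'] [Algebra S B'] (ρ : R →+* S)
    (f : A →+* A') (g : B →+* B') (hf : ∀ r, f (algebraMap R A r) = algebraMap S A' (ρ r))
    (hg : ∀ r, g (algebraMap R B r) = algebraMap S B' (ρ r)) : A ⊗[R] B →+* A' ⊗[S] B' :=
  letI : Algebra R (A' ⊗[S] B') :=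
    ((algebraMap S (A' ⊗[S] B')).comp ρ).toAlgebra' fun r x => Algebra.commutes (ρ r) x
  (Algebra.TensorProduct.lift (R := R) (S := R) (C := A' ⊗[S] B')
    { Algebra.TensorProduct.includeLeftRingHom.comp f with
      commutes' := fun r => by
        change (f (algebraMap R A r)) ⊗ₜ[S] (1 : B') = algebraMap S A' (ρ r) ⊗ₜ[S] 1
        rw [hf] }
    { (Algebra.TensorProduct.includeRight (R := S) (A := A') (B := B')).toRingHom.comp g with
      commutes' := fun r => by
        change (1 : A') ⊗ₜ[S] g (algebraMap R B r) = algebraMap S A' (ρ r) ⊗ₜ[S] 1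
        rw [hg, Algebra.algebraMap_eq_smul_one, Algebra.algebraMap_eq_smul_one,
          TensorProduct.smul_tmul] }
    (fun a b => by
      change (f a ⊗ₜ[S] (1 : B')) * ((1 : A') ⊗ₜ[S] g b) =
        ((1 : A') ⊗ₜ[S] g b) * (f a ⊗ₜ[S] (1 : B'))
      simp)).toRingHom

lemma tensorMap_tmul {R S : Type u} [CommRing R] [CommRing S] {A B A' B' : Type u} [Ring A]
    [Ring B] [Ring A'] [Ring B'] [Algebra R A] [Algebra R B] [Algebra S A'] [Algebra S B']
    (ρ : R →+* S) (f : A →+* A') (g : B →+* B')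
    (hf : ∀ r, f (algebraMap R A r) = algebraMap S A' (ρ r))
    (hg : ∀ r, g (algebraMap R B r) = algebraMap S B' (ρ r)) (a : A) (b : B) :
    tensorMap ρ f g hf hg (a ⊗ₜ b) = f a ⊗ₜ g b := by
  change (f a ⊗ₜ[S] (1 : B')) * ((1 : A') ⊗ₜ[S] g b) = _
  simp

/-! ### Modules and algebras over a ringed space -/

section Sheaf

variable (X : RingedSpace.{u, u})

/-- The structure sheaf `𝒪_X`, as a sheaf of (commutative) rings. -/
abbrev structureSheaf : TopCat.Sheaf RingCat.{u} X :=
  (sheafCompose _ (forget₂ CommRingCat.{u} RingCat.{u})).obj X.sheaf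

variable {X}

/-- The sections over `U` of an `𝒪_X`-module. -/
abbrev Sec (F : SheafOfModules.{u} (structureSheaf X)) (U : (Opens X)ᵒᵖ) : Type u :=
  F.val.obj U

instance (F : SheafOfModules.{u} (structureSheaf X)) (U : (Opens X)ᵒᵖ) :
    Module (X.presheaf.obj U) (Sec F U) :=
  (F.val.obj U).isModule

/-- The restriction maps of an `𝒪_X`-module. -/
def secMap (F : SheafOfModules.{u} (structureSheaf X)) {U V : (Opens X)ᵒᵖ} (f : U ⟶ V) :
    Sec F U →ₛₗ[(X.presheaf.map f).hom] Sec F V :=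
  F.val.restrictₛₗ f

lemma secMap_id (F : SheafOfModules.{u} (structureSheaf X)) (U : (Opens X)ᵒᵖ) (s : Sec F U) :
    secMap F (𝟙 U) s = s := by
  have := F.val.presheaf.map_id U
  exact ConcreteCategory.congr_hom this s

lemma secMap_comp (F : SheafOfModules.{u} (structureSheaf X)) {U V W : (Opens X)ᵒᵖ}
    (f : U ⟶ V) (g : V ⟶ W) (s : Sec F U) :
    secMap F (f ≫ g) s = secMap F g (secMap F f s) :=
  F.val.map_comp_apply f g s

variable (X) in
/-- A presheaf of `𝒪_X`-algebras: a presheaf of rings with a central morphism from `𝒪_X`. -/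
structure AlgPresheaf where
  /-- the underlying presheaf of rings -/
  presheaf : TopCat.Presheaf RingCat.{u} X
  /-- the structure morphism -/
  unit : (structureSheaf X).obj ⟶ presheaf
  central : ∀ (U : (Opens X)ᵒᵖ) (r : (structureSheaf X).obj.obj U) (s : presheaf.obj U),
    (unit.app U).hom r * s = s * (unit.app U).hom r

variable (X) in
/-- A sheaf of `𝒪_X`-algebras. -/
structure AlgSheaf extends AlgPresheaf X where
  isSheaf : presheaf.IsSheaf

instance (A : AlgPresheaf X) (U : (Opens X)ᵒᵖ) :
    Algebra (X.presheaf.obj U) (A.presheaf.obj U) :=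
  RingHom.toAlgebra' (A.unit.app U).hom (A.central U)

lemma AlgPresheaf.map_algebraMap (A : AlgPresheaf X) {U V : (Opens X)ᵒᵖ} (f : U ⟶ V)
    (r : X.presheaf.obj U) :
    (A.presheaf.map f).hom (algebraMap (X.presheaf.obj U) (A.presheaf.obj U) r) =
      algebraMap (X.presheaf.obj V) (A.presheaf.obj V) ((X.presheaf.map f).hom r) :=
  (ConcreteCategory.congr_hom (A.unit.naturality f) r).symm

/-- Two sheaves of `𝒪_X`-algebras are isomorphic if there is an isomorphism of sheaves of rings
between them which is compatible with the structure morphisms. -/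
def AlgSheaf.IsIsomorphic (A B : AlgSheaf X) : Prop :=
  ∃ e : A.presheaf ≅ B.presheaf, A.unit ≫ e.hom = B.unit

/-- The sheaf of `𝒪_X`-algebras associated to a presheaf of `𝒪_X`-algebras. -/
def AlgPresheaf.sheafify (A : AlgPresheaf X) : AlgSheaf X where
  presheaf := CategoryTheory.sheafify (Opens.grothendieckTopology X) A.presheaf
  unit := A.unit ≫ toSheafify (Opens.grothendieckTopology X) A.presheaf
  isSheaf :=
    ((presheafToSheaf (Opens.grothendieckTopology X) RingCat.{u}).obj A.presheaf).property
  central U r s := by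
    have hsep := Sheaf.isSeparated
      ((presheafToSheaf (Opens.grothendieckTopology X) RingCat.{u}).obj A.presheaf)
    refine hsep (unop U) (Presheaf.imageSieve (toSheafify _ A.presheaf) s)
      (Presheaf.imageSieve_mem _ _ _) _ _ ?_
    rintro V f ⟨t, ht⟩
    have hnat := ConcreteCategory.congr_hom ((A.unit ≫ toSheafify (Opens.grothendieckTopology X)
      A.presheaf).naturality f.op) r
    have hc := congrArg ((toSheafify (Opens.grothendieckTopology X) A.presheaf).app (op V)).hom
      (A.central (op V) (((structureSheaf X).obj.map f.op).hom r) t)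
    rw [map_mul, map_mul] at hc
    refine (map_mul (((CategoryTheory.sheafify (Opens.grothendieckTopology X) A.presheaf).map
      f.op).hom) _ _).trans (Eq.trans ?_ (map_mul (((CategoryTheory.sheafify
        (Opens.grothendieckTopology X) A.presheaf).map f.op).hom) _ _).symm)
    have hnat' : ((CategoryTheory.sheafify (Opens.grothendieckTopology X) A.presheaf).map
        f.op).hom (((A.unit ≫ toSheafify (Opens.grothendieckTopology X) A.presheaf).app U).hom r) =
        ((toSheafify (Opens.grothendieckTopology X) A.presheaf).app (op V)).hom
          ((A.unit.app (op V)).hom (((structureSheaf X).obj.map f.op).hom r)) := hnat.symm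
    have ht' : ((CategoryTheory.sheafify (Opens.grothendieckTopology X) A.presheaf).map
        f.op).hom s =
        ((toSheafify (Opens.grothendieckTopology X) A.presheaf).app (op V)).hom t := ht.symm
    rw [hnat', ht']
    exact hc

/-- The canonical morphism from a presheaf of algebras to the associated sheaf. -/
abbrev AlgPresheaf.toSheafify (A : AlgPresheaf X) : A.presheaf ⟶ A.sheafify.presheaf :=
  CategoryTheory.toSheafify (Opens.grothendieckTopology X) A.presheaf

/-! ### Tensor products, ideals and quotients -/

/-- The presheaf of rings `U ↦ A(U) ⊗ B(U)`. -/
def AlgPresheaf.tensorRings (A B : AlgPresheaf X) : TopCat.Presheaf RingCat.{u} X where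
  obj U := RingCat.of (A.presheaf.obj U ⊗[X.presheaf.obj U] B.presheaf.obj U)
  map {U V} f := RingCat.ofHom (tensorMap (X.presheaf.map f).hom
    (A.presheaf.map f).hom (B.presheaf.map f).hom (A.map_algebraMap f) (B.map_algebraMap f))
  map_id U := by
    refine RingCat.hom_ext (RingHom.ext fun x => ?_)
    change tensorMap (X.presheaf.map (𝟙 U)).hom (A.presheaf.map (𝟙 U)).hom (B.presheaf.map (𝟙 U)).hom
      (A.map_algebraMap (𝟙 U)) (B.map_algebraMap (𝟙 U)) x = x
    induction x using TensorProduct.induction_on with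
    | zero => exact map_zero _
    | tmul a b =>
      rw [tensorMap_tmul, A.presheaf.map_id, B.presheaf.map_id]
      rfl
    | add x y hx hy => rw [map_add, hx, hy]
  map_comp {U V W} f g := by
    refine RingCat.hom_ext (RingHom.ext fun x => ?_)
    change tensorMap (X.presheaf.map (f ≫ g)).hom (A.presheaf.map (f ≫ g)).hom (B.presheaf.map (f ≫ g)).hom
      (A.map_algebraMap (f ≫ g)) (B.map_algebraMap (f ≫ g)) x =
      tensorMap (X.presheaf.map g).hom (A.presheaf.map g).hom (B.presheaf.map g).hom
      (A.map_algebraMap g) (B.map_algebraMap g)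
      (tensorMap (X.presheaf.map f).hom (A.presheaf.map f).hom (B.presheaf.map f).hom
      (A.map_algebraMap f) (B.map_algebraMap f) x)
    induction x using TensorProduct.induction_on with
    | zero => simp only [map_zero]
    | tmul a b =>
      rw [tensorMap_tmul, tensorMap_tmul, tensorMap_tmul, A.presheaf.map_comp,
        B.presheaf.map_comp]
      rfl
    | add x y hx hy => rw [map_add, map_add, map_add, hx, hy]

/-- The presheaf of `𝒪_X`-algebras `U ↦ A(U) ⊗ B(U)`. -/
def AlgPresheaf.tensor (A B : AlgPresheaf X) : AlgPresheaf X where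
  presheaf := A.tensorRings B
  unit :=
    { app := fun U => RingCat.ofHom (algebraMap (X.presheaf.obj U)
        (A.presheaf.obj U ⊗[X.presheaf.obj U] B.presheaf.obj U))
      naturality := fun U V f => by
        refine RingCat.hom_ext (RingHom.ext fun (r : X.presheaf.obj U) => ?_)
        change algebraMap (X.presheaf.obj V) (A.presheaf.obj V) ((X.presheaf.map f).hom r) ⊗ₜ
            (1 : B.presheaf.obj V) =
          tensorMap (X.presheaf.map f).hom (A.presheaf.map f).hom (B.presheaf.map f).hom
            (A.map_algebraMap f) (B.map_algebraMap f)
            (algebraMap (X.presheaf.obj U) (A.presheaf.obj U) r ⊗ₜ 1)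
        rw [tensorMap_tmul, A.map_algebraMap, map_one] }
  central U r s := Algebra.commutes (R := X.presheaf.obj U)
    (A := A.presheaf.obj U ⊗[X.presheaf.obj U] B.presheaf.obj U) r s

/-- The tensor product `A ⊗ B` over `𝒪_X` of two sheaves of `𝒪_X`-algebras. -/
def AlgSheaf.tensor (A B : AlgSheaf X) : AlgSheaf X :=
  (A.toAlgPresheaf.tensor B.toAlgPresheaf).sheafify

/-- A presheaf of two-sided ideals of a presheaf of algebras. -/
structure IdealPresheaf (A : AlgPresheaf X) where
  /-- the ideal of sections over `U` -/
  ideal (U : (Opens X)ᵒᵖ) : TwoSidedIdeal (A.presheaf.obj U)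
  map_mem : ∀ {U V : (Opens X)ᵒᵖ} (f : U ⟶ V) (s : A.presheaf.obj U), s ∈ ideal U →
    (A.presheaf.map f).hom s ∈ ideal V

namespace IdealPresheaf

/-- The presheaf of ideals generated by a family of sections: over `U` it is the two-sided ideal
generated by the restrictions to `U` of the given sections. -/
def span (A : AlgPresheaf X) (S : ∀ U : (Opens X)ᵒᵖ, Set (A.presheaf.obj U)) :
    IdealPresheaf A where
  ideal U := TwoSidedIdeal.span
    {s | ∃ (V : (Opens X)ᵒᵖ) (f : V ⟶ U), ∃ t ∈ S V, s = (A.presheaf.map f).hom t}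
  map_mem {U V} f s hs := by
    rw [← TwoSidedIdeal.mem_comap (A.presheaf.map f).hom]
    revert s
    change TwoSidedIdeal.span _ ≤ _
    rw [TwoSidedIdeal.span_le]
    rintro _ ⟨W, g, t, ht, rfl⟩
    rw [SetLike.mem_coe, TwoSidedIdeal.mem_comap]
    refine TwoSidedIdeal.subset_span ⟨W, g ≫ f, t, ht, ?_⟩
    rw [A.presheaf.map_comp]
    rfl

/-- The sum of two presheaves of ideals. -/
def add {A : AlgPresheaf X} (I J : IdealPresheaf A) : IdealPresheaf A where
  ideal U := I.ideal U ⊔ J.ideal U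
  map_mem {U V} f s hs := by
    rw [← TwoSidedIdeal.mem_comap (A.presheaf.map f).hom]
    revert s
    change I.ideal U ⊔ J.ideal U ≤
      TwoSidedIdeal.comap (A.presheaf.map f).hom (I.ideal V ⊔ J.ideal V)
    refine sup_le (fun s hs => ?_) (fun s hs => ?_)
    · exact (TwoSidedIdeal.mem_comap _).2 (TwoSidedIdeal.mem_sup_left (I.map_mem f s hs))
    · exact (TwoSidedIdeal.mem_comap _).2 (TwoSidedIdeal.mem_sup_right (J.map_mem f s hs))

/-- The ideal sheaf associated to a presheaf of ideals of a sheaf of algebras (as a subsheaf of the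
latter): its sections are those which locally belong to the given ideals. -/
def sheafify {A : AlgSheaf X} (I : IdealPresheaf A.toAlgPresheaf) :
    IdealPresheaf A.toAlgPresheaf where
  ideal U := TwoSidedIdeal.mk'
    {s | ∀ x ∈ unop U, ∃ (V : (Opens X)ᵒᵖ) (f : U ⟶ V), x ∈ unop V ∧
      (A.presheaf.map f).hom s ∈ I.ideal V}
    (fun x hx => ⟨U, 𝟙 U, hx, by rw [map_zero]; exact TwoSidedIdeal.zero_mem _⟩)
    (fun {s t} hs ht x hx => by
      obtain ⟨V, f, hV, h⟩ := hs x hx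
      obtain ⟨W, g, hW, h'⟩ := ht x hx
      let a : V ⟶ op (unop V ⊓ unop W) := (homOfLE inf_le_left).op
      let b : W ⟶ op (unop V ⊓ unop W) := (homOfLE inf_le_right).op
      have e : f ≫ a = g ≫ b := Subsingleton.elim _ _
      refine ⟨_, f ≫ a, ⟨hV, hW⟩, ?_⟩
      rw [map_add]
      refine TwoSidedIdeal.add_mem _ ?_ ?_
      · rw [A.presheaf.map_comp]
        exact I.map_mem a _ h
      · rw [e, A.presheaf.map_comp]
        exact I.map_mem b _ h')
    (fun {s} hs x hx => by
      obtain ⟨V, f, hV, h⟩ := hs x hx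
      exact ⟨V, f, hV, by rw [map_neg]; exact TwoSidedIdeal.neg_mem _ h⟩)
    (fun {s t} ht x hx => by
      obtain ⟨V, f, hV, h⟩ := ht x hx
      exact ⟨V, f, hV, by rw [map_mul]; exact TwoSidedIdeal.mul_mem_left _ _ _ h⟩)
    (fun {s t} hs x hx => by
      obtain ⟨V, f, hV, h⟩ := hs x hx
      exact ⟨V, f, hV, by rw [map_mul]; exact TwoSidedIdeal.mul_mem_right _ _ _ h⟩)
  map_mem {U W} g s hs := by
    rw [TwoSidedIdeal.mem_mk'] at hs ⊢
    intro x hx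
    obtain ⟨V, f, hV, h⟩ := hs x (g.unop.le hx)
    let a : V ⟶ op (unop V ⊓ unop W) := (homOfLE inf_le_left).op
    let b : W ⟶ op (unop V ⊓ unop W) := (homOfLE inf_le_right).op
    have e : g ≫ b = f ≫ a := Subsingleton.elim _ _
    refine ⟨_, b, ⟨hV, hx⟩, ?_⟩
    have h2 := I.map_mem a _ h
    have e2 : (A.presheaf.map b).hom ((A.presheaf.map g).hom s) =
        (A.presheaf.map a).hom ((A.presheaf.map f).hom s) := by
      have h3 : A.presheaf.map g ≫ A.presheaf.map b = A.presheaf.map f ≫ A.presheaf.map a := by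
        rw [← A.presheaf.map_comp, e, A.presheaf.map_comp]
      exact ConcreteCategory.congr_hom h3 s
    rw [e2]
    exact h2

end IdealPresheaf

/-- The presheaf of rings `U ↦ A(U) / I(U)`. -/
def AlgPresheaf.quotientPresheaf (A : AlgPresheaf X) (I : IdealPresheaf A) :
    TopCat.Presheaf RingCat.{u} X where
  obj U := RingCat.of (I.ideal U).ringCon.Quotient
  map {U V} f := RingCat.ofHom ((I.ideal U).ringCon.lift
    ((I.ideal V).ringCon.mk'.comp (A.presheaf.map f).hom) (by
      intro s t h
      rw [TwoSidedIdeal.rel_iff] at h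
      refine (RingCon.eq _).2 ?_
      rw [TwoSidedIdeal.rel_iff, ← map_sub]
      exact I.map_mem f _ h))
  map_id U := by
    refine RingCat.hom_ext (RingHom.ext fun x => ?_)
    obtain ⟨s, rfl⟩ := (I.ideal U).ringCon.mk'_surjective x
    change (I.ideal U).ringCon.mk' ((A.presheaf.map (𝟙 U)).hom s) = _
    rw [A.presheaf.map_id]
    rfl
  map_comp {U V W} f g := by
    refine RingCat.hom_ext (RingHom.ext fun x => ?_)
    obtain ⟨s, rfl⟩ := (I.ideal U).ringCon.mk'_surjective x
    change (I.ideal W).ringCon.mk' ((A.presheaf.map (f ≫ g)).hom s) = _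
    rw [A.presheaf.map_comp]
    rfl

/-- The projections `A(U) → A(U) / I(U)`. -/
def AlgPresheaf.quotientMap (A : AlgPresheaf X) (I : IdealPresheaf A) :
    A.presheaf ⟶ A.quotientPresheaf I where
  app U := RingCat.ofHom (I.ideal U).ringCon.mk'
  naturality _ _ _ := rfl

/-- The presheaf of `𝒪_X`-algebras `U ↦ A(U) / I(U)`. -/
def AlgPresheaf.quotient (A : AlgPresheaf X) (I : IdealPresheaf A) : AlgPresheaf X where
  presheaf := A.quotientPresheaf I
  unit := A.unit ≫ A.quotientMap I
  central U r x := by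
    obtain ⟨s, rfl⟩ := (I.ideal U).ringCon.mk'_surjective x
    exact ((I.ideal U).ringCon.mk'.map_mul _ _).symm.trans
      ((congrArg (I.ideal U).ringCon.mk' (A.central U r s)).trans
        ((I.ideal U).ringCon.mk'.map_mul _ _))

/-- The quotient of a sheaf of algebras by an ideal sheaf. -/
def AlgSheaf.quotient (A : AlgSheaf X) (I : IdealPresheaf A.toAlgPresheaf) : AlgSheaf X :=
  (A.toAlgPresheaf.quotient I).sheafify

/-! ### The sheaf of twisted path algebras -/

section Path

variable (Q : FinQuiver.{u}) (M : Q.E → SheafOfModules.{u} (structureSheaf X))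

/-- The presheaf `U ↦ T_{B(U)}(M(U))`, with `B = ⨁ᵢ 𝒪_X eᵢ` and `M = ⨁ₐ Mₐ`. -/
def pathAlgPresheaf : AlgPresheaf X where
  presheaf :=
    { obj := fun U => RingCat.of (PathAlg (X.presheaf.obj U) Q fun a => Sec (M a) U)
      map := fun f => RingCat.ofHom
        (PathAlg.map (X.presheaf.map f).hom fun a => secMap (M a) f)
      map_id := fun U => by
        ext1
        refine PathAlg.ringHom_ext fun x => ?_
        refine (PathAlg.map_gen _ _ x).trans ?_
        refine congrArg (PathAlg.gen (X.presheaf.obj U) Q fun a => Sec (M a) U) ?_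
        refine Prod.ext (funext fun i => ?_) (funext fun a => secMap_id (M a) U (x.2 a))
        exact ConcreteCategory.congr_hom (X.presheaf.map_id U) (x.1 i)
      map_comp := fun {U V W} f g => by
        ext1
        refine PathAlg.ringHom_ext fun x => ?_
        refine (PathAlg.map_gen _ _ x).trans ?_
        refine Eq.trans ?_ (congrArg (PathAlg.map (X.presheaf.map g).hom fun a => secMap (M a) g)
          (PathAlg.map_gen (X.presheaf.map f).hom (fun a => secMap (M a) f) x)).symm
        rw [PathAlg.map_gen]
        refine congrArg (PathAlg.gen (X.presheaf.obj W) Q fun a => Sec (M a) W) ?_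
        refine Prod.ext (funext fun i => ?_) (funext fun a => secMap_comp (M a) f g (x.2 a))
        exact ConcreteCategory.congr_hom (X.presheaf.map_comp f g) (x.1 i) }
  unit :=
    { app := fun U => RingCat.ofHom
        (algebraMap (X.presheaf.obj U) (PathAlg (X.presheaf.obj U) Q fun a => Sec (M a) U))
      naturality := fun U V f => by
        ext r
        exact (PathAlg.map_algebraMap (X.presheaf.map f).hom (fun a => secMap (M a) f) r).symm }
  central U r s := Algebra.commutes (R := X.presheaf.obj U) r s

/-- The `M`-twisted path algebra of `Q`, a sheaf of `𝒪_X`-algebras: the tensor algebra of the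
`B`-bimodule `M = ⨁ₐ Mₐ` over `B = ⨁ᵢ 𝒪_X eᵢ`. -/
def pathAlgebra : AlgSheaf X := (pathAlgPresheaf Q M).sheafify

/-- The section of the path algebra given by a section of `Mₐ`. -/
def arrowSection {U : (Opens X)ᵒᵖ} (a : Q.E) (m : Sec (M a) U) :
    (pathAlgebra Q M).presheaf.obj U :=
  ((pathAlgPresheaf Q M).toSheafify.app U).hom
    (PathAlg.arrow (X.presheaf.obj U) Q (fun a => Sec (M a) U) a m)

/-- The presheaf `U ↦ F₁(U) ⊗ ⋯ ⊗ Fₙ(U)`. -/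
def tensorPresheaf {n : ℕ} (F : Fin n → SheafOfModules.{u} (structureSheaf X)) :
    TopCat.Presheaf AddCommGrpCat.{u} X where
  obj U := AddCommGrpCat.of (⨂[X.presheaf.obj U] k, Sec (F k) U)
  map f := AddCommGrpCat.ofHom (piTensorMap (X.presheaf.map f).hom fun k => secMap (F k) f)
  map_id U := by
    ext1
    refine piTensor_addHom_ext fun r m => (piTensorMap_smul_tprod _ _ r m).trans ?_
    simp only [secMap_id]
    exact congrArg (fun c : X.presheaf.obj U => c • PiTensorProduct.tprod (X.presheaf.obj U) m)
      (ConcreteCategory.congr_hom (X.presheaf.map_id U) r)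
  map_comp {U V W} f g := by
    ext1
    refine piTensor_addHom_ext fun r m => (piTensorMap_smul_tprod _ _ r m).trans ?_
    refine Eq.trans ?_ (congrArg (piTensorMap (X.presheaf.map g).hom fun k => secMap (F k) g)
      (piTensorMap_smul_tprod (X.presheaf.map f).hom (fun k => secMap (F k) f) r m)).symm
    rw [piTensorMap_smul_tprod]
    simp only [secMap_comp]
    exact congrArg (fun c : X.presheaf.obj W => c • PiTensorProduct.tprod (X.presheaf.obj W) _)
      (ConcreteCategory.congr_hom (X.presheaf.map_comp f g) r)

/-- The (underlying sheaf of abelian groups of the) tensor product `F₁ ⊗ ⋯ ⊗ Fₙ` of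
`𝒪_X`-modules. -/
def tensorSheaf {n : ℕ} (F : Fin n → SheafOfModules.{u} (structureSheaf X)) :
    TopCat.Sheaf AddCommGrpCat.{u} X :=
  (presheafToSheaf (Opens.grothendieckTopology X) AddCommGrpCat.{u}).obj (tensorPresheaf F)

/-- The sheaf `M_p = M_{α₁} ⊗ ⋯ ⊗ M_{αₖ}` of a path `p = α₁ ⋯ αₖ`. -/
def pathSheaf (p : Q.Path) : TopCat.Sheaf AddCommGrpCat.{u} X :=
  tensorSheaf fun k => M (p.edge k)

/-- The canonical morphism (multiplication) from the presheaf tensor product along `p`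
to the presheaf path algebra. -/
def pathToAlgPresheaf (p : Q.Path) :
    tensorPresheaf (fun k => M (p.edge k)) ⟶
      (pathAlgPresheaf Q M).presheaf ⋙ forget₂ RingCat.{u} AddCommGrpCat.{u} where
  app U := AddCommGrpCat.ofHom
    (PathAlg.tensorMap (X.presheaf.obj U) Q (fun a => Sec (M a) U) p.edge).toAddMonoidHom
  naturality U V f := by
    ext1
    refine piTensor_addHom_ext fun r m => ?_
    refine (congrArg (PathAlg.tensorMap (X.presheaf.obj V) Q (fun a => Sec (M a) V) p.edge)
      (piTensorMap_smul_tprod (X.presheaf.map f).hom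
        (fun k => secMap (M (p.edge k)) f) r m)).trans ?_
    exact (PathAlg.map_tensorMap (X.presheaf.map f).hom (fun a => secMap (M a) f) p.edge r m).symm

/-- The canonical morphism `M_p → T_B(M)`. -/
def pathToAlg (p : Q.Path) :
    (pathSheaf Q M p).obj ⟶
      (pathAlgebra Q M).presheaf ⋙ forget₂ RingCat.{u} AddCommGrpCat.{u} :=
  sheafifyLift (Opens.grothendieckTopology X)
    (pathToAlgPresheaf Q M p ≫
      Functor.whiskerRight (pathAlgPresheaf Q M).toSheafify (forget₂ RingCat.{u} AddCommGrpCat.{u}))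
    (((sheafCompose (Opens.grothendieckTopology X) (forget₂ RingCat.{u} AddCommGrpCat.{u})).obj
      ⟨_, (pathAlgebra Q M).isSheaf⟩).property)

/-- A relation: a finite sum `∑ m_p`, `m_p ∈ M_p(X)`, over paths `p` of length at least two with a
common tail and a common head. -/
structure Relation where
  /-- the common tail of the paths -/
  tail : Q.V
  /-- the common head of the paths -/
  head : Q.V
  /-- the finite set of paths occurring in the sum -/
  support : Finset Q.Path
  /-- the terms of the sum (only the terms at paths in `support` are used) -/
  term (p : Q.Path) : (pathSheaf Q M p).obj.obj (op ⊤)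
  two_le : ∀ p ∈ support, 2 ≤ p.length
  tail_eq : ∀ p ∈ support, p.tail = tail
  head_eq : ∀ p ∈ support, p.head = head

variable {Q M}

/-- The global section of the path algebra given by a relation. -/
def Relation.toSection (r : Relation Q M) : (pathAlgebra Q M).presheaf.obj (op ⊤) :=
  ∑ p ∈ r.support, ((pathToAlg Q M p).app (op ⊤)).hom (r.term p)

end Path

/-- The presheaf of ideals generated by a set of global sections. -/
def globalSpan (A : AlgPresheaf X) (S : Set (A.presheaf.obj (op ⊤))) : IdealPresheaf A :=
  IdealPresheaf.span A fun _ => {s | ∃ t ∈ S, s = (A.presheaf.map (homOfLE le_top).op).hom t}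

/-- The ideal sheaf generated by a set of relations. -/
def relationIdeal {Q : FinQuiver.{u}} {M : Q.E → SheafOfModules.{u} (structureSheaf X)}
    (S : Set (Relation Q M)) : IdealPresheaf (pathAlgebra Q M).toAlgPresheaf :=
  (globalSpan _ (Relation.toSection '' S)).sheafify

/-! ### The path algebra of the tensor quiver -/

section Tensor

variable {Q' Q'' : FinQuiver.{u}} (M' : Q'.E → SheafOfModules.{u} (structureSheaf X))
  (M'' : Q''.E → SheafOfModules.{u} (structureSheaf X))

/-- The twisting modules `M_(α,j) = M'_α` and `M_(i,β) = M''_β` of the tensor quiver. -/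
def tensorTwist : (Q'.tensor Q'').E → SheafOfModules.{u} (structureSheaf X) :=
  Sum.elim (fun a => M' a.1) (fun b => M'' b.2)

/-- The element `m_(r',j)`: each summand `m_p` of `r'` is viewed as a section of
`M_(p,j) = M'_p`. -/
def leftSection (r : Relation Q' M') (j : Q''.V) :
    (pathAlgebra (Q'.tensor Q'') (tensorTwist M' M'')).presheaf.obj (op ⊤) :=
  ∑ p ∈ r.support,
    ((pathToAlg (Q'.tensor Q'') (tensorTwist M' M'') (p.left Q'' j)).app (op ⊤)).hom (r.term p)

/-- The element `m_(i,r'')`: each summand `m_q` of `r''` is viewed as a section of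
`M_(i,q) = M''_q`. -/
def rightSection (i : Q'.V) (r : Relation Q'' M'') :
    (pathAlgebra (Q'.tensor Q'') (tensorTwist M' M'')).presheaf.obj (op ⊤) :=
  ∑ q ∈ r.support,
    ((pathToAlg (Q'.tensor Q'') (tensorTwist M' M'') (q.right Q' i)).app (op ⊤)).hom (r.term q)

/-- The commutativity ideal `I`, generated over all open sets `U` by the differences
`m''_(hα,β) ⊗ m'_(α,tβ) - m'_(α,hβ) ⊗ m''_(tα,β)` for `m' ∈ M'_α(U)` and `m'' ∈ M''_β(U)`. -/
def commIdeal :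
    IdealPresheaf (pathAlgebra (Q'.tensor Q'') (tensorTwist M' M'')).toAlgPresheaf :=
  (IdealPresheaf.span _ fun U : (Opens X)ᵒᵖ => {s | ∃ (α : Q'.E) (β : Q''.E) (m' : Sec (M' α) U)
      (m'' : Sec (M'' β) U),
    s = arrowSection (Q'.tensor Q'') (tensorTwist M' M'') (Sum.inr (Q'.h α, β)) m'' *
          arrowSection (Q'.tensor Q'') (tensorTwist M' M'') (Sum.inl (α, Q''.t β)) m' -
        arrowSection (Q'.tensor Q'') (tensorTwist M' M'') (Sum.inl (α, Q''.h β)) m' *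
          arrowSection (Q'.tensor Q'') (tensorTwist M' M'') (Sum.inr (Q'.t α, β)) m''}).sheafify

/-- The ideal `I'`, generated by the sums `∑ⱼ m_(r',j)` for `r' ∈ R'`. -/
def leftIdeal (R' : Set (Relation Q' M')) :
    IdealPresheaf (pathAlgebra (Q'.tensor Q'') (tensorTwist M' M'')).toAlgPresheaf :=
  (globalSpan _ ((fun r => ∑ j : Q''.V, leftSection M' M'' r j) '' R')).sheafify

/-- The ideal `I''`, generated by the sums `∑ᵢ m_(i,r'')` for `r'' ∈ R''`. -/
def rightIdeal (R'' : Set (Relation Q'' M'')) :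
    IdealPresheaf (pathAlgebra (Q'.tensor Q'') (tensorTwist M' M'')).toAlgPresheaf :=
  (globalSpan _ ((fun r => ∑ i : Q'.V, rightSection M' M'' i r) '' R'')).sheafify

end Tensor

end Sheaf

end TwistedPathAlgebra

end

open TwistedPathAlgebra

/-! Both sides corepresent the same functor on sheaves of `𝒪_X`-algebras. By the universal property
of the tensor algebra, a morphism from a twisted path algebra to a sheaf of algebras `C` is a
representation of the quiver in `C`: a complete system of orthogonal idempotents `e_i` and linear
maps `M_a → e_{ha} C e_{ta}`, compatible with restriction (`SheafRep.univ_push_desc`,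
`SheafRep.hom_ext`). A morphism out of a tensor product of algebras is a pair of morphisms with
commuting images.

Part (a) therefore amounts to a bijection between representations of `Q' ⊗ Q''` satisfying the
commutation relations and commuting pairs of representations of `Q'` and `Q''`. From left to right
one sums over the other index: `e_i = ∑_j e_(i,j)`, `α(m) = ∑_j (α,j)(m)`, and symmetrically. From
right to left one multiplies: `e_(i,j) = e_i e_j`, `(α,j)(m) = α(m) e_j`, `(i,β)(n) = e_i β(n)`.
These constructions are mutually inverse (`Rep.left_tensor`, `Rep.right_tensor`,
`Rep.tensor_left_right`).

For part (b), summation over the other index defines morphisms `leftHom` and `rightHom` from the two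
path algebras to that of `Q' ⊗ Q''`. Arrows lying over different `j` multiply to zero, so the image
of a product along a nontrivial path is the sum over `j` of the products along its copies. Hence
`leftHom` sends a relation `r'` to `∑_j m_(r',j)` (`leftHom_toSection`), and a morphism kills `I'`
exactly when its composite with `leftHom` kills `R'`; likewise on the right.

Sheafification and sheaf quotients are not surjective on sections. Local surjectivity takes the
place of surjectivity: an equation in a sheaf can be tested locally, hence on elements of the
presheaf path algebra. `Presents` records what is needed of a quotient, and
`isIsomorphic_tensor_of_presents` proves both parts at once. -/

noncomputable section

namespace TwistedPathAlgebra

/-! ### Representations of a twisted quiver in an algebra over a ring. -/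

section Rep

/-- A representation of the bimodule `M` over `B = ⨁ᵢ R eᵢ` in an `R`-algebra `A`: a complete
system of orthogonal idempotents `eᵢ` and linear maps `Mₐ → e_{ha} A e_{ta}`. -/
@[ext]
structure Rep (R : Type u) [CommRing R] (Q : FinQuiver.{u}) (M : Q.E → Type u)
    [∀ a, AddCommGroup (M a)] [∀ a, Module R (M a)] (A : Type u) [Ring A] [Algebra R A] where
  /-- the idempotent of a vertex -/
  vert : Q.V → A
  /-- the linear map of an edge -/
  arrow (a : Q.E) : M a →ₗ[R] A
  sum_vert : ∑ i, vert i = 1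
  vert_mul_self (i : Q.V) : vert i * vert i = vert i
  vert_mul_of_ne {i j : Q.V} (h : i ≠ j) : vert i * vert j = 0
  vert_mul_arrow (a : Q.E) (m : M a) : vert (Q.h a) * arrow a m = arrow a m
  arrow_mul_vert (a : Q.E) (m : M a) : arrow a m * vert (Q.t a) = arrow a m

variable {R : Type u} [CommRing R] {Q : FinQuiver.{u}} {M : Q.E → Type u}
  [∀ a, AddCommGroup (M a)] [∀ a, Module R (M a)]
  {A : Type u} [Ring A] [Algebra R A] {B : Type u} [Ring B] [Algebra R B]

namespace Rep

section Basic

variable (ρ : Rep R Q M A)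

lemma vert_mul_arrow_of_ne {i : Q.V} {a : Q.E} (h : i ≠ Q.h a) (m : M a) :
    ρ.vert i * ρ.arrow a m = 0 := by
  rw [← ρ.vert_mul_arrow, ← mul_assoc, ρ.vert_mul_of_ne h, zero_mul]

lemma arrow_mul_vert_of_ne {i : Q.V} {a : Q.E} (h : Q.t a ≠ i) (m : M a) :
    ρ.arrow a m * ρ.vert i = 0 := by
  rw [← ρ.arrow_mul_vert, mul_assoc, ρ.vert_mul_of_ne h, mul_zero]

lemma arrow_mul_arrow_of_ne {a b : Q.E} (h : Q.t a ≠ Q.h b) (m : M a) (n : M b) :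
    ρ.arrow a m * ρ.arrow b n = 0 := by
  rw [← ρ.vert_mul_arrow b, ← mul_assoc, ρ.arrow_mul_vert_of_ne h, zero_mul]

open Classical in
lemma vert_mul_vert (i j : Q.V) : ρ.vert i * ρ.vert j = if i = j then ρ.vert i else 0 := by
  split_ifs with h
  · rw [← h, ρ.vert_mul_self]
  · exact ρ.vert_mul_of_ne h

open Classical in
lemma vert_mul_arrow' (i : Q.V) (a : Q.E) (m : M a) :
    ρ.vert i * ρ.arrow a m = if i = Q.h a then ρ.arrow a m else 0 := by
  split_ifs with h
  · rw [h, ρ.vert_mul_arrow]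
  · exact ρ.vert_mul_arrow_of_ne h m

open Classical in
lemma arrow_mul_vert' (i : Q.V) (a : Q.E) (m : M a) :
    ρ.arrow a m * ρ.vert i = if Q.t a = i then ρ.arrow a m else 0 := by
  split_ifs with h
  · rw [← h, ρ.arrow_mul_vert]
  · exact ρ.arrow_mul_vert_of_ne h m

/-- The image of a representation under an algebra morphism. -/
def map (f : A →ₐ[R] B) : Rep R Q M B where
  vert i := f (ρ.vert i)
  arrow a := f.toLinearMap ∘ₗ ρ.arrow a
  sum_vert := by rw [← map_sum, ρ.sum_vert, map_one]
  vert_mul_self i := by rw [← map_mul, ρ.vert_mul_self]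
  vert_mul_of_ne h := by rw [← map_mul, ρ.vert_mul_of_ne h, map_zero]
  vert_mul_arrow a m := by
    simp only [LinearMap.comp_apply, AlgHom.toLinearMap_apply]
    rw [← map_mul, ρ.vert_mul_arrow]
  arrow_mul_vert a m := by
    simp only [LinearMap.comp_apply, AlgHom.toLinearMap_apply]
    rw [← map_mul, ρ.arrow_mul_vert]

/-- The linear map `B ⊕ M → A` of a representation. -/
def total : (Q.V → R) × ((a : Q.E) → M a) →ₗ[R] A :=
  LinearMap.coprod (∑ i, (LinearMap.toSpanSingleton R A (ρ.vert i)) ∘ₗ LinearMap.proj i)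
    (∑ a, ρ.arrow a ∘ₗ LinearMap.proj a)

lemma total_apply (x : (Q.V → R) × ((a : Q.E) → M a)) :
    ρ.total x = ∑ i, x.1 i • ρ.vert i + ∑ a, ρ.arrow a (x.2 a) := by
  simp [total]

/-- The algebra morphism from the path algebra given by a representation. -/
def lift : PathAlg R Q M →ₐ[R] A := by
  classical
  exact PathAlg.lift ρ.total (by simp [total_apply, ρ.sum_vert])
    -- In each of the three remaining relations the product is a double sum over vertices or edges,
    -- and orthogonality of the idempotents leaves only the matching terms.
    (fun b c => by
      simp [total_apply, Finset.sum_mul_sum, vert_mul_vert, smul_smul, mul_comm])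
    (fun b m => by
      rw [total_apply, total_apply, total_apply]
      simp only [map_zero, Pi.zero_apply, zero_smul, Finset.sum_const_zero, add_zero, zero_add]
      rw [Finset.sum_mul_sum, Finset.sum_comm]
      simp [vert_mul_arrow'])
    (fun m b => by
      simp [total_apply, Finset.sum_mul_sum, arrow_mul_vert'])

lemma lift_gen (x : (Q.V → R) × ((a : Q.E) → M a)) :
    ρ.lift (PathAlg.gen R Q M x) = ρ.total x :=
  PathAlg.lift_gen _ _ _ _ _ x

end Basic

variable (R Q M) in
open Classical in
/-- The tautological representation in the path algebra. -/
def canonical : Rep R Q M (PathAlg R Q M) where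
  vert i := PathAlg.gen R Q M (Pi.single i 1, 0)
  arrow a := PathAlg.arrow R Q M a
  sum_vert := by
    rw [← map_sum, ← PathAlg.gen_one]
    congr 1
    ext j
    · simp [Prod.fst_sum, Finset.sum_apply, Pi.single_apply]
    · simp [Prod.snd_sum]
  vert_mul_self i := by
    rw [PathAlg.gen_mul]; congr 2; ext j; by_cases h : j = i <;> simp [h]
  vert_mul_of_ne {i j} h := by
    rw [PathAlg.gen_mul, ← map_zero (PathAlg.gen R Q M)]
    congr 2
    ext k
    by_cases hk : k = i
    · subst hk; simp [h]
    · simp [hk]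
  vert_mul_arrow a m := by
    refine (PathAlg.gen_left _ _).trans ?_
    simp only [PathAlg.arrow, LinearMap.comp_apply]
    congr 2
    ext c
    by_cases h : c = a
    · subst h; simp
    · simp [h]
  arrow_mul_vert a m := by
    refine (PathAlg.gen_right _ _).trans ?_
    simp only [PathAlg.arrow, LinearMap.comp_apply]
    congr 2
    ext c
    by_cases h : c = a
    · subst h; simp
    · simp [h]

open Classical in
lemma canonical_vert (i : Q.V) :
    (canonical R Q M).vert i = PathAlg.gen R Q M (Pi.single i 1, 0) := rfl

@[simp] lemma canonical_arrow (a : Q.E) (m : M a) :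
    (canonical R Q M).arrow a m = PathAlg.arrow R Q M a m := rfl

/-- Decomposes an arbitrary generator into scalar multiples of vertices plus arrows, so that later
arguments need only treat these. -/
lemma canonical_total (x : (Q.V → R) × ((a : Q.E) → M a)) :
    (canonical R Q M).total x = PathAlg.gen R Q M x := by
  classical
  simp only [total_apply, canonical_vert, canonical_arrow, PathAlg.arrow, LinearMap.comp_apply]
  rw [← map_sum, Finset.sum_congr rfl fun i _ => (map_smul (PathAlg.gen R Q M) (x.1 i) _).symm,
    ← map_sum, ← map_add]
  congr 1
  ext j
  · simp [Prod.fst_sum, Finset.sum_apply, Pi.single_apply]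
  · simp [Prod.snd_sum, Finset.sum_apply]

@[simp] lemma lift_vert (ρ : Rep R Q M A) (i : Q.V) :
    ρ.lift ((canonical R Q M).vert i) = ρ.vert i := by
  classical
  rw [canonical_vert, lift_gen, total_apply]
  simp [Pi.single_apply]

@[simp] lemma lift_arrow (ρ : Rep R Q M A) (a : Q.E) (m : M a) :
    ρ.lift (PathAlg.arrow R Q M a m) = ρ.arrow a m := by
  classical
  rw [PathAlg.arrow, LinearMap.comp_apply, lift_gen, total_apply]
  simp only [LinearMap.comp_apply, LinearMap.inr_apply, LinearMap.single_apply]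
  rw [Finset.sum_eq_single a]
  · simp
  · intro b _ hb; simp [hb]
  · simp

lemma lift_tensorMap_smul_tprod (ρ : Rep R Q M A) {n : ℕ} (a : Fin n → Q.E) (c : R)
    (m : ∀ k, M (a k)) :
    ρ.lift (PathAlg.tensorMap R Q M a (c • PiTensorProduct.tprod R m)) =
      c • (List.ofFn fun k => ρ.arrow (a k) (m k)).prod := by
  rw [map_smul, map_smul]
  congr 1
  simp only [PathAlg.tensorMap, PiTensorProduct.lift.tprod, MultilinearMap.compLinearMap_apply,
    MultilinearMap.mkPiAlgebraFin_apply, map_list_prod, List.map_ofFn]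
  congr 2
  ext k
  exact ρ.lift_arrow (a k) (m k)

end Rep

/-- Ring morphisms out of a path algebra are determined by their values on scalars, vertices and
edges. -/
lemma PathAlg.ringHom_ext' {S : Type u} [Ring S] {f g : PathAlg R Q M →+* S}
    (h0 : ∀ r : R, f (algebraMap R _ r) = g (algebraMap R _ r))
    (h1 : ∀ i, f ((Rep.canonical R Q M).vert i) = g ((Rep.canonical R Q M).vert i))
    (h2 : ∀ a m, f (PathAlg.arrow R Q M a m) = g (PathAlg.arrow R Q M a m)) : f = g := by
  refine PathAlg.ringHom_ext fun x => ?_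
  simp only [← Rep.canonical_total, Rep.total_apply, map_add, map_sum, Algebra.smul_def, map_mul,
    h0, h1, h2, Rep.canonical_arrow]

/-- Scalars, vertices and arrows generate the path algebra as a ring. This serves to extend
commutation from generators to all elements. -/
lemma PathAlg.induction {p : PathAlg R Q M → Prop} (h0 : ∀ r : R, p (algebraMap R _ r))
    (h1 : ∀ i, p ((Rep.canonical R Q M).vert i)) (h2 : ∀ a m, p (PathAlg.arrow R Q M a m))
    (hmul : ∀ x y, p x → p y → p (x * y)) (hadd : ∀ x y, p x → p y → p (x + y)) (x) : p x := by
  have hsum {ι : Type u} [Fintype ι] (f : ι → PathAlg R Q M) (h : ∀ i, p (f i)) :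
      p (∑ i, f i) :=
    Finset.sum_induction f p hadd (by simpa using h0 0) fun i _ => h i
  obtain ⟨x, rfl⟩ := RingQuot.mkAlgHom_surjective R (TensorRel R Q M) x
  induction x using TensorAlgebra.induction with
  | algebraMap r => rw [AlgHom.commutes]; exact h0 r
  | ι x =>
    have h : p (PathAlg.gen R Q M x) := by
      rw [← Rep.canonical_total, Rep.total_apply]
      refine hadd _ _ (hsum _ fun i => ?_) (hsum _ fun a => h2 a _)
      rw [Algebra.smul_def]
      exact hmul _ _ (h0 _) (h1 i)
    exact h
  | mul a b ha hb => rw [map_mul]; exact hmul _ _ ha hb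
  | add a b ha hb => rw [map_add]; exact hadd _ _ ha hb

lemma PathAlg.map_vert {S : Type u} [CommRing S] {N : Q.E → Type u}
    [∀ a, AddCommGroup (N a)] [∀ a, Module S (N a)] (ρ : R →+* S) (f : ∀ a, M a →ₛₗ[ρ] N a)
    (i : Q.V) :
    PathAlg.map ρ f ((Rep.canonical R Q M).vert i) = (Rep.canonical S Q N).vert i := by
  classical
  rw [Rep.canonical_vert, Rep.canonical_vert, PathAlg.map_gen]
  congr 1
  ext j
  · by_cases h : j = i
    · subst h; simp
    · simp [h]
  · simp

end Rep

/-! ### Representations of the tensor quiver and commuting pairs of representations. -/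

section Tensor

namespace FinQuiver

variable {Q' Q'' : FinQuiver.{u}}

/-- The vertex `(i, j)` of the tensor quiver. -/
def tensorVert (i : Q'.V) (j : Q''.V) : (Q'.tensor Q'').V := (i, j)

/-- The edge `(α, j)` of the tensor quiver. -/
def tensorLeft (α : Q'.E) (j : Q''.V) : (Q'.tensor Q'').E := Sum.inl (α, j)

/-- The edge `(i, β)` of the tensor quiver. -/
def tensorRight (i : Q'.V) (β : Q''.E) : (Q'.tensor Q'').E := Sum.inr (i, β)

@[simp] lemma h_tensorLeft (α : Q'.E) (j : Q''.V) :
    (Q'.tensor Q'').h (tensorLeft α j) = tensorVert (Q'.h α) j := rfl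

@[simp] lemma t_tensorLeft (α : Q'.E) (j : Q''.V) :
    (Q'.tensor Q'').t (tensorLeft α j) = tensorVert (Q'.t α) j := rfl

@[simp] lemma h_tensorRight (i : Q'.V) (β : Q''.E) :
    (Q'.tensor Q'').h (tensorRight i β) = tensorVert i (Q''.h β) := rfl

@[simp] lemma t_tensorRight (i : Q'.V) (β : Q''.E) :
    (Q'.tensor Q'').t (tensorRight i β) = tensorVert i (Q''.t β) := rfl

@[simp] lemma tensorVert_inj {i i' : Q'.V} {j j' : Q''.V} :
    tensorVert i j = tensorVert i' j' ↔ i = i' ∧ j = j' := Prod.mk_inj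

lemma tensorVert_cases {p : (Q'.tensor Q'').V → Prop} (h : ∀ i j, p (tensorVert i j)) (x) : p x :=
  h x.1 x.2

lemma sum_tensorVert {A : Type*} [AddCommMonoid A] (f : (Q'.tensor Q'').V → A) :
    ∑ x, f x = ∑ i, ∑ j, f (tensorVert i j) :=
  Fintype.sum_prod_type (f := fun x : Q'.V × Q''.V => f x)

/-- Case distinction on the edges of the tensor quiver. -/
@[elab_as_elim]
def tensorEdgeRec {p : (Q'.tensor Q'').E → Sort*} (left : ∀ α j, p (tensorLeft α j))
    (right : ∀ i β, p (tensorRight i β)) : ∀ a, p a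
  | Sum.inl (α, j) => left α j
  | Sum.inr (i, β) => right i β

end FinQuiver

open FinQuiver

-- The modules `N` on the tensor quiver are arbitrary, with chosen isomorphisms `l` and `r` to those
-- of the factors. This avoids transport along equalities of modules; for sheaves of sections both
-- isomorphisms are the identity.
variable {R : Type u} [CommRing R] {Q' Q'' : FinQuiver.{u}} {M' : Q'.E → Type u}
  [∀ a, AddCommGroup (M' a)] [∀ a, Module R (M' a)] {M'' : Q''.E → Type u}
  [∀ a, AddCommGroup (M'' a)] [∀ a, Module R (M'' a)]
  {N : (Q'.tensor Q'').E → Type u} [∀ a, AddCommGroup (N a)] [∀ a, Module R (N a)]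
  {A : Type u} [Ring A] [Algebra R A] {B : Type u} [Ring B] [Algebra R B]
  (l : ∀ α j, M' α ≃ₗ[R] N (tensorLeft α j)) (r : ∀ i β, M'' β ≃ₗ[R] N (tensorRight i β))

namespace Rep

/-- The representation of the first factor underlying a representation of a tensor quiver. -/
def left (σ : Rep R (Q'.tensor Q'') N A) : Rep R Q' M' A where
  vert i := ∑ j : Q''.V, σ.vert (tensorVert i j)
  arrow α := ∑ j : Q''.V, σ.arrow (tensorLeft α j) ∘ₗ (l α j).toLinearMap
  sum_vert := by rw [← sum_tensorVert, σ.sum_vert]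
  vert_mul_self i := by
    classical
    simp [Finset.sum_mul_sum, vert_mul_vert]
  vert_mul_of_ne {i j} h := by
    classical
    simp [Finset.sum_mul_sum, vert_mul_vert, h]
  vert_mul_arrow α m := by
    classical
    simp [Finset.sum_mul_sum, vert_mul_arrow']
  arrow_mul_vert α m := by
    classical
    simp [Finset.sum_mul_sum, arrow_mul_vert']

/-- The representation of the second factor underlying a representation of a tensor quiver. -/
def right (σ : Rep R (Q'.tensor Q'') N A) : Rep R Q'' M'' A where
  vert j := ∑ i : Q'.V, σ.vert (tensorVert i j)
  arrow β := ∑ i : Q'.V, σ.arrow (tensorRight i β) ∘ₗ (r i β).toLinearMap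
  sum_vert := by rw [Finset.sum_comm, ← sum_tensorVert, σ.sum_vert]
  vert_mul_self i := by
    classical
    simp [Finset.sum_mul_sum, vert_mul_vert]
  vert_mul_of_ne {i j} h := by
    classical
    simp [Finset.sum_mul_sum, vert_mul_vert, h]
  vert_mul_arrow β m := by
    classical
    simp [Finset.sum_mul_sum, vert_mul_arrow']
  arrow_mul_vert β m := by
    classical
    simp [Finset.sum_mul_sum, arrow_mul_vert']

lemma left_vert (σ : Rep R (Q'.tensor Q'') N A) (i : Q'.V) :
    (left l σ).vert i = ∑ j, σ.vert (tensorVert i j) := rfl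

lemma right_vert (σ : Rep R (Q'.tensor Q'') N A) (j : Q''.V) :
    (right r σ).vert j = ∑ i, σ.vert (tensorVert i j) := rfl

lemma left_arrow (σ : Rep R (Q'.tensor Q'') N A) (α : Q'.E) (m : M' α) :
    (left l σ).arrow α m = ∑ j, σ.arrow (tensorLeft α j) (l α j m) := by
  simp [left]

lemma right_arrow (σ : Rep R (Q'.tensor Q'') N A) (β : Q''.E) (m : M'' β) :
    (right r σ).arrow β m = ∑ i, σ.arrow (tensorRight i β) (r i β m) := by
  simp [right]

/-- Two representations in the same algebra commute if their values do. -/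
structure Commutes (ρ : Rep R Q' M' A) (τ : Rep R Q'' M'' A) : Prop where
  vert_vert (i j) : Commute (ρ.vert i) (τ.vert j)
  vert_arrow (i β m) : Commute (ρ.vert i) (τ.arrow β m)
  arrow_vert (α m j) : Commute (ρ.arrow α m) (τ.vert j)
  arrow_arrow (α m β n) : Commute (ρ.arrow α m) (τ.arrow β n)

/-- The representation of the tensor quiver given by two commuting representations. -/
def tensor {ρ : Rep R Q' M' A} {τ : Rep R Q'' M'' A} (h : Commutes ρ τ) :
    Rep R (Q'.tensor Q'') N A where
  vert x := ρ.vert x.1 * τ.vert x.2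
  arrow a := tensorEdgeRec (p := fun a => N a →ₗ[R] A)
    (fun α j => LinearMap.mulRight R (τ.vert j) ∘ₗ ρ.arrow α ∘ₗ (l α j).symm.toLinearMap)
    (fun i β => LinearMap.mulLeft R (ρ.vert i) ∘ₗ τ.arrow β ∘ₗ (r i β).symm.toLinearMap) a
  sum_vert := by
    refine (sum_tensorVert _).trans ?_
    change ∑ i, ∑ j, ρ.vert i * τ.vert j = 1
    rw [← Finset.sum_mul_sum, ρ.sum_vert, τ.sum_vert, one_mul]
  vert_mul_self x := by
    rw [← mul_assoc, mul_assoc (ρ.vert x.1), ← (h.vert_vert x.1 x.2).eq, ← mul_assoc,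
      ρ.vert_mul_self, mul_assoc, τ.vert_mul_self]
  vert_mul_of_ne {x y} hne := by
    rw [← mul_assoc, mul_assoc (ρ.vert x.1), ← (h.vert_vert y.1 x.2).eq, ← mul_assoc]
    by_cases h1 : x.1 = y.1
    · rw [mul_assoc, τ.vert_mul_of_ne fun h2 => hne (Prod.ext h1 h2), mul_zero]
    · rw [ρ.vert_mul_of_ne h1, zero_mul, zero_mul]
  vert_mul_arrow a m := by
    obtain ⟨α, j⟩ | ⟨i, β⟩ := a
    · change ρ.vert (Q'.h α) * τ.vert j * (ρ.arrow α ((l α j).symm m) * τ.vert j) =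
        ρ.arrow α ((l α j).symm m) * τ.vert j
      rw [(h.arrow_vert _ _ _).eq, mul_assoc, ← mul_assoc (τ.vert j), τ.vert_mul_self,
        ← (h.arrow_vert _ _ _).eq, ← mul_assoc, ρ.vert_mul_arrow]
    · change ρ.vert i * τ.vert (Q''.h β) * (ρ.vert i * τ.arrow β ((r i β).symm m)) =
        ρ.vert i * τ.arrow β ((r i β).symm m)
      rw [← mul_assoc, mul_assoc (ρ.vert i), ← (h.vert_vert _ _).eq, ← mul_assoc,
        ρ.vert_mul_self, mul_assoc, τ.vert_mul_arrow]
  arrow_mul_vert a m := by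
    obtain ⟨α, j⟩ | ⟨i, β⟩ := a
    · change ρ.arrow α ((l α j).symm m) * τ.vert j * (ρ.vert (Q'.t α) * τ.vert j) =
        ρ.arrow α ((l α j).symm m) * τ.vert j
      rw [← mul_assoc, mul_assoc (ρ.arrow α _), ← (h.vert_vert _ _).eq, ← mul_assoc,
        ρ.arrow_mul_vert, mul_assoc, τ.vert_mul_self]
    · change ρ.vert i * τ.arrow β ((r i β).symm m) * (ρ.vert i * τ.vert (Q''.t β)) =
        ρ.vert i * τ.arrow β ((r i β).symm m)
      rw [(h.vert_arrow _ _ _).eq, mul_assoc, ← mul_assoc (ρ.vert i), ρ.vert_mul_self,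
        ← mul_assoc, ← (h.vert_arrow _ _ _).eq, mul_assoc, τ.arrow_mul_vert]

/-- The elements commuting with a given one form a subalgebra, so an induction in each variable
reduces the claim to generators. -/
lemma Commutes.lift {ρ : Rep R Q' M' A} {τ : Rep R Q'' M'' A} (h : Commutes ρ τ)
    (x : PathAlg R Q' M') (y : PathAlg R Q'' M'') : Commute (ρ.lift x) (τ.lift y) := by
  induction x using PathAlg.induction with
  | h0 r => rw [AlgHom.commutes]; exact Algebra.commutes _ _
  | hmul x x' hx hx' => rw [map_mul]; exact hx.mul_left hx'
  | hadd x x' hx hx' => rw [map_add]; exact hx.add_left hx'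
  | h1 i =>
    rw [lift_vert]
    induction y using PathAlg.induction with
    | h0 r => rw [AlgHom.commutes]; exact (Algebra.commutes _ _).symm
    | hmul y y' hy hy' => rw [map_mul]; exact hy.mul_right hy'
    | hadd y y' hy hy' => rw [map_add]; exact hy.add_right hy'
    | h1 j => rw [lift_vert]; exact h.vert_vert i j
    | h2 b n => rw [lift_arrow]; exact h.vert_arrow i b n
  | h2 a m =>
    rw [lift_arrow]
    induction y using PathAlg.induction with
    | h0 r => rw [AlgHom.commutes]; exact (Algebra.commutes _ _).symm
    | hmul y y' hy hy' => rw [map_mul]; exact hy.mul_right hy'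
    | hadd y y' hy hy' => rw [map_add]; exact hy.add_right hy'
    | h1 j => rw [lift_vert]; exact h.arrow_vert a m j
    | h2 b n => rw [lift_arrow]; exact h.arrow_arrow a m b n

variable {l r}
variable {ρ : Rep R Q' M' A} {τ : Rep R Q'' M'' A} (h : Commutes ρ τ)

lemma tensor_vert (i : Q'.V) (j : Q''.V) :
    (tensor l r h).vert (tensorVert i j) = ρ.vert i * τ.vert j := rfl

lemma tensor_arrow_left (α : Q'.E) (j : Q''.V) (m) :
    (tensor l r h).arrow (tensorLeft α j) m = ρ.arrow α ((l α j).symm m) * τ.vert j := rfl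

lemma tensor_arrow_right (i : Q'.V) (β : Q''.E) (m) :
    (tensor l r h).arrow (tensorRight i β) m = ρ.vert i * τ.arrow β ((r i β).symm m) := rfl

/-- The second factor contributes `∑_j e_j = 1`. With `right_tensor` this recovers a commuting pair
from its tensor representation. -/
lemma left_tensor : left l (tensor l r h) = ρ := by
  refine Rep.ext (funext fun i => ?_) (funext fun α => LinearMap.ext fun m => ?_)
  · simp only [left_vert, tensor_vert]
    rw [← Finset.mul_sum, τ.sum_vert, mul_one]
  · simp only [left_arrow, tensor_arrow_left, LinearEquiv.symm_apply_apply]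
    rw [← Finset.mul_sum, τ.sum_vert, mul_one]

lemma right_tensor : right r (tensor l r h) = τ := by
  refine Rep.ext (funext fun i => ?_) (funext fun α => LinearMap.ext fun m => ?_)
  · simp only [right_vert, tensor_vert]
    rw [← Finset.sum_mul, ρ.sum_vert, one_mul]
  · simp only [right_arrow, tensor_arrow_right, LinearEquiv.symm_apply_apply]
    rw [← Finset.sum_mul, ρ.sum_vert, one_mul]

variable (l r) in
/-- The commutation relations of a tensor quiver hold in a representation. -/
def IsComm (σ : Rep R (Q'.tensor Q'') N A) : Prop :=
  ∀ (α : Q'.E) (β : Q''.E) (m : M' α) (n : M'' β),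
    σ.arrow (tensorRight (Q'.h α) β) (r _ _ n) * σ.arrow (tensorLeft α (Q''.t β)) (l _ _ m) =
      σ.arrow (tensorLeft α (Q''.h β)) (l _ _ m) * σ.arrow (tensorRight (Q'.t α) β) (r _ _ n)

/-- Once the idempotents are moved past the other representation and absorbed by the adjacent
arrows, both sides equal `ρ(m) τ(n)`. -/
lemma isComm_tensor : IsComm l r (tensor l r h) := by
  intro α β m n
  simp only [tensor_arrow_left, tensor_arrow_right, LinearEquiv.symm_apply_apply]
  rw [(h.arrow_vert α m _).eq, mul_assoc, ← mul_assoc (τ.arrow β n), τ.arrow_mul_vert,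
    ← (h.arrow_arrow _ _ _ _).eq, ← mul_assoc, ρ.vert_mul_arrow, (h.vert_arrow _ _ _).eq,
    mul_assoc (ρ.arrow α m), ← mul_assoc (τ.vert _), τ.vert_mul_arrow,
    ← (h.vert_arrow _ _ _).eq, ← mul_assoc, ρ.arrow_mul_vert]

/-- Only the commutation of arrows with arrows uses `hσ`; the other three cases follow from
orthogonality of the idempotents. -/
lemma commutes_left_right {σ : Rep R (Q'.tensor Q'') N A} (hσ : IsComm l r σ) :
    Commutes (left l σ) (right r σ) where
  vert_vert i j := by
    classical
    simp [Commute, SemiconjBy, left_vert, right_vert, Finset.sum_mul_sum, vert_mul_vert, ite_and]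
  vert_arrow i β m := by
    classical
    simp [Commute, SemiconjBy, left_vert, right_arrow, Finset.sum_mul_sum, vert_mul_arrow',
      arrow_mul_vert', ite_and]
  arrow_vert α m j := by
    classical
    simp [Commute, SemiconjBy, left_arrow, right_vert, Finset.sum_mul_sum, vert_mul_arrow',
      arrow_mul_vert', ite_and]
  arrow_arrow α m β n := by
    classical
    simp only [Commute, SemiconjBy, left_arrow, right_arrow, Finset.sum_mul_sum]
    -- Each double sum has one composable term: `(α,j)(i,β)` requires `j = hβ` and `i = tα`, while
    -- `(i,β)(α,j)` requires `i = hα` and `j = tβ`. The two survivors are the two sides of the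
    -- commutation relation.
    rw [Finset.sum_eq_single (Q''.h β), Finset.sum_eq_single (Q'.t α),
      Finset.sum_eq_single (Q'.h α), Finset.sum_eq_single (Q''.t β), hσ]
    · intro j _ hj
      exact σ.arrow_mul_arrow_of_ne (by simpa using hj.symm) _ _
    · simp
    · intro i _ hi
      exact Finset.sum_eq_zero fun j _ => σ.arrow_mul_arrow_of_ne (by simp [hi]) _ _
    · simp
    · intro i _ hi
      exact σ.arrow_mul_arrow_of_ne (by simpa using hi.symm) _ _
    · simp
    · intro j _ hj
      exact Finset.sum_eq_zero fun i _ => σ.arrow_mul_arrow_of_ne (by simp [hj]) _ _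
    · simp

/-- In the product of a sum over `j` with a sum over `i`, orthogonality isolates the vertex `(i,j)`.
In the same way multiplying by an idempotent of the other factor singles out one copy of an arrow.
-/
lemma tensor_left_right {σ : Rep R (Q'.tensor Q'') N A} (hσ : IsComm l r σ) :
    tensor l r (commutes_left_right hσ) = σ := by
  classical
  refine Rep.ext (funext fun x => ?_) (funext fun a => LinearMap.ext fun m => ?_)
  · induction x using tensorVert_cases with | h i j => ?_
    rw [tensor_vert]
    simp [left_vert, right_vert, Finset.sum_mul_sum, vert_mul_vert, ite_and]
  · induction a using tensorEdgeRec with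
    | left α j =>
      rw [tensor_arrow_left]
      simp [left_arrow, right_vert, Finset.sum_mul_sum, arrow_mul_vert', ite_and]
    | right i β =>
      rw [tensor_arrow_right]
      simp [left_vert, right_arrow, Finset.sum_mul_sum, vert_mul_arrow', ite_and]

lemma ext_left_right {σ σ' : Rep R (Q'.tensor Q'') N A} (hσ : IsComm l r σ)
    (hσ' : IsComm l r σ') (hl : left l σ = left l σ') (hr : right r σ = right r σ') : σ = σ' := by
  rw [← tensor_left_right hσ, ← tensor_left_right hσ']
  congr 1

lemma left_map (σ : Rep R (Q'.tensor Q'') N A) (f : A →ₐ[R] B) :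
    left l (σ.map f) = (left l σ).map f :=
  Rep.ext (funext fun _ => (map_sum f _ _).symm) (funext fun α => LinearMap.ext fun m => by
    simp [left, map])

lemma right_map (σ : Rep R (Q'.tensor Q'') N A) (f : A →ₐ[R] B) :
    right r (σ.map f) = (right r σ).map f :=
  Rep.ext (funext fun _ => (map_sum f _ _).symm) (funext fun β => LinearMap.ext fun m => by
    simp [right, map])

lemma IsComm.map {σ : Rep R (Q'.tensor Q'') N A} (hσ : IsComm l r σ) (f : A →ₐ[R] B) :
    IsComm l r (σ.map f) := fun α β m n => by
  have := congrArg f (hσ α β m n)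
  rwa [map_mul, map_mul] at this

/-- Expanding the product, any term whose index changes between neighbouring factors vanishes. At
least one factor is needed: the empty product is `1`, whereas the right-hand side would be the
number of indices. -/
lemma _root_.List.prod_ofFn_sum_of_mul_eq_zero {ι : Type*} [Fintype ι] {A : Type*} [Ring A]
    {n : ℕ} (f : Fin (n + 1) → ι → A)
    (hf : ∀ k l i j, i ≠ j → f k i * f l j = 0) :
    (List.ofFn fun k => ∑ j, f k j).prod = ∑ j, (List.ofFn fun k => f k j).prod := by
  classical
  induction n with
  | zero => simp
  | succ n ih =>
    simp only [List.ofFn_succ (n := n + 1), List.prod_cons]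
    rw [ih (fun k => f k.succ) fun k l i j h => hf _ _ i j h, Finset.sum_mul_sum]
    refine Finset.sum_congr rfl fun i _ => Finset.sum_eq_single i (fun j _ hj => ?_) (by simp)
    rw [List.ofFn_succ, List.prod_cons, ← mul_assoc, hf _ _ _ _ hj.symm, zero_mul]

/-- The arrows `(α,i)` and `(α',j)` with `i ≠ j` are never composable, since head and tail keep the
second coordinate. Thus only paths staying over one vertex of `Q''` contribute. -/
lemma prod_left_arrow (σ : Rep R (Q'.tensor Q'') N A) {n : ℕ} (hn : 0 < n) (a : Fin n → Q'.E)
    (m : ∀ k, M' (a k)) :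
    (List.ofFn fun k => (left l σ).arrow (a k) (m k)).prod =
      ∑ j, (List.ofFn fun k => σ.arrow (tensorLeft (a k) j) (l (a k) j (m k))).prod := by
  obtain ⟨n, rfl⟩ := Nat.exists_eq_succ_of_ne_zero hn.ne'
  simp only [left_arrow]
  exact List.prod_ofFn_sum_of_mul_eq_zero _ fun k l i j h =>
    σ.arrow_mul_arrow_of_ne (by simp [h]) _ _

lemma prod_right_arrow (σ : Rep R (Q'.tensor Q'') N A) {n : ℕ} (hn : 0 < n) (a : Fin n → Q''.E)
    (m : ∀ k, M'' (a k)) :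
    (List.ofFn fun k => (right r σ).arrow (a k) (m k)).prod =
      ∑ i, (List.ofFn fun k => σ.arrow (tensorRight i (a k)) (r i (a k) (m k))).prod := by
  obtain ⟨n, rfl⟩ := Nat.exists_eq_succ_of_ne_zero hn.ne'
  simp only [right_arrow]
  exact List.prod_ofFn_sum_of_mul_eq_zero _ fun k l i j h =>
    σ.arrow_mul_arrow_of_ne (by simp [h]) _ _

/-- The algebraic source of the sums `∑_j m_(r',j)`: it computes the left representation on one pure
tensor along a path. -/
lemma left_lift_tensorMap_smul_tprod (σ : Rep R (Q'.tensor Q'') N A) {n : ℕ} (hn : 0 < n)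
    (a : Fin n → Q'.E) (c : R) (m : ∀ k, M' (a k)) :
    (left l σ).lift (PathAlg.tensorMap R Q' M' a (c • PiTensorProduct.tprod R m)) =
      ∑ j, σ.lift (PathAlg.tensorMap R (Q'.tensor Q'') N (fun k => tensorLeft (a k) j)
        (c • PiTensorProduct.tprod R fun k => l (a k) j (m k))) := by
  simp only [lift_tensorMap_smul_tprod]
  rw [prod_left_arrow σ hn, Finset.smul_sum]

lemma right_lift_tensorMap_smul_tprod (σ : Rep R (Q'.tensor Q'') N A) {n : ℕ} (hn : 0 < n)
    (a : Fin n → Q''.E) (c : R) (m : ∀ k, M'' (a k)) :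
    (right r σ).lift (PathAlg.tensorMap R Q'' M'' a (c • PiTensorProduct.tprod R m)) =
      ∑ i, σ.lift (PathAlg.tensorMap R (Q'.tensor Q'') N (fun k => tensorRight i (a k))
        (c • PiTensorProduct.tprod R fun k => r i (a k) (m k))) := by
  simp only [lift_tensorMap_smul_tprod]
  rw [prod_right_arrow σ hn, Finset.smul_sum]

end Rep
end Tensor
end TwistedPathAlgebra
end

noncomputable section

namespace TwistedPathAlgebra

/-! ### Morphisms of presheaves of algebras and universal properties of the sheaf constructions. -/

section SheafHom

variable {X : RingedSpace.{u, u}}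

/-- A morphism of presheaves of `𝒪_X`-algebras. -/
@[ext]
structure AlgPresheaf.Hom (A B : AlgPresheaf X) where
  /-- the underlying morphism of presheaves of rings -/
  nat : A.presheaf ⟶ B.presheaf
  unit_nat : A.unit ≫ nat = B.unit

namespace AlgPresheaf.Hom

variable {A B C D : AlgPresheaf X}

/-- The identity morphism. -/
def id (A : AlgPresheaf X) : Hom A A := ⟨𝟙 _, Category.comp_id _⟩

/-- The composition of morphisms. -/
def comp (f : Hom A B) (g : Hom B C) : Hom A C :=
  ⟨f.nat ≫ g.nat, by rw [← Category.assoc, f.unit_nat, g.unit_nat]⟩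

/-- The map on sections over an open set. -/
def app (f : Hom A B) (U : (Opens X)ᵒᵖ) :
    A.presheaf.obj U →ₐ[X.presheaf.obj U] B.presheaf.obj U :=
  { (f.nat.app U).hom with
    commutes' := fun r => ConcreteCategory.congr_hom (NatTrans.congr_app f.unit_nat U) r }

lemma app_map (f : Hom A B) {U V : (Opens X)ᵒᵖ} (i : U ⟶ V) (s : A.presheaf.obj U) :
    f.app V ((A.presheaf.map i).hom s) = (B.presheaf.map i).hom (f.app U s) :=
  ConcreteCategory.congr_hom (f.nat.naturality i) s

@[simp] lemma comp_app (f : Hom A B) (g : Hom B C) (U : (Opens X)ᵒᵖ) (s : A.presheaf.obj U) :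
    (f.comp g).app U s = g.app U (f.app U s) := rfl

lemma comp_assoc (f : Hom A B) (g : Hom B C) (h : Hom C D) :
    (f.comp g).comp h = f.comp (g.comp h) := rfl

lemma comp_id (f : Hom A B) : f.comp (id B) = f := rfl

lemma ext_app {f g : Hom A B} (h : ∀ U s, f.app U s = g.app U s) : f = g := by
  refine Hom.ext (NatTrans.ext (funext fun U => ?_))
  exact RingCat.hom_ext (RingHom.ext fun s => h U s)

/-- A morphism from a family of ring morphisms commuting with structure maps and restrictions. -/
def mk' (φ : ∀ U, A.presheaf.obj U →+* B.presheaf.obj U)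
    (hφ : ∀ U (r : X.presheaf.obj U), φ U (algebraMap _ _ r) = algebraMap _ _ r)
    (h : ∀ (U V : (Opens X)ᵒᵖ) (i : U ⟶ V) (s : A.presheaf.obj U),
      φ V ((A.presheaf.map i).hom s) = (B.presheaf.map i).hom (φ U s)) : Hom A B where
  nat :=
    { app := fun U => RingCat.ofHom (φ U)
      naturality := fun U V i => RingCat.hom_ext (RingHom.ext fun s => h U V i s) }
  unit_nat := NatTrans.ext (funext fun U => RingCat.hom_ext (RingHom.ext fun r => hφ U r))

end AlgPresheaf.Hom

lemma AlgSheaf.isIsomorphic_of_hom {A B : AlgSheaf X}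
    (f : AlgPresheaf.Hom A.toAlgPresheaf B.toAlgPresheaf)
    (g : AlgPresheaf.Hom B.toAlgPresheaf A.toAlgPresheaf)
    (hfg : f.comp g = .id _) (hgf : g.comp f = .id _) : A.IsIsomorphic B :=
  ⟨⟨f.nat, g.nat, congrArg AlgPresheaf.Hom.nat hfg, congrArg AlgPresheaf.Hom.nat hgf⟩, f.unit_nat⟩

/-! ### The sheafification -/

section Sheafify

variable (A : AlgPresheaf X) {C : AlgSheaf X}

/-- The canonical morphism to the associated sheaf. -/
def AlgPresheaf.toSheaf : AlgPresheaf.Hom A A.sheafify.toAlgPresheaf := ⟨A.toSheafify, rfl⟩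

variable {A}

/-- The universal property of the associated sheaf. -/
def AlgPresheaf.Hom.sheafLift (f : AlgPresheaf.Hom A C.toAlgPresheaf) :
    AlgPresheaf.Hom A.sheafify.toAlgPresheaf C.toAlgPresheaf where
  nat := CategoryTheory.sheafifyLift (Opens.grothendieckTopology X) f.nat C.isSheaf
  unit_nat := by
    refine (Category.assoc _ _ _).trans ((congrArg (A.unit ≫ ·) ?_).trans f.unit_nat)
    exact toSheafify_sheafifyLift _ _ _

lemma AlgPresheaf.Hom.toSheaf_comp_sheafLift (f : AlgPresheaf.Hom A C.toAlgPresheaf) :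
    A.toSheaf.comp f.sheafLift = f :=
  AlgPresheaf.Hom.ext (toSheafify_sheafifyLift _ _ _)

lemma AlgPresheaf.Hom.sheafLift_toSheaf (f : AlgPresheaf.Hom A C.toAlgPresheaf)
    (U : (Opens X)ᵒᵖ) (s : A.presheaf.obj U) :
    f.sheafLift.app U (A.toSheaf.app U s) = f.app U s := by
  conv_rhs => rw [← f.toSheaf_comp_sheafLift]
  rfl

lemma AlgPresheaf.Hom.sheafify_ext
    {f g : AlgPresheaf.Hom A.sheafify.toAlgPresheaf C.toAlgPresheaf}
    (h : A.toSheaf.comp f = A.toSheaf.comp g) : f = g :=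
  AlgPresheaf.Hom.ext (sheafify_hom_ext _ _ _ C.isSheaf (congrArg AlgPresheaf.Hom.nat h))

/-- Separatedness, in the form used for every local verification: the opens on which `s` restricts
to zero form a covering sieve. -/
lemma AlgSheaf.eq_zero_of_locally (C : AlgSheaf X) {U : (Opens X)ᵒᵖ} (s : C.presheaf.obj U)
    (h : ∀ x ∈ unop U, ∃ (V : (Opens X)ᵒᵖ) (f : U ⟶ V), x ∈ unop V ∧
      (C.presheaf.map f).hom s = 0) : s = 0 := by
  have hsep := Sheaf.isSeparated (J := Opens.grothendieckTopology X) ⟨C.presheaf, C.isSheaf⟩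
  let S : Sieve (unop U) :=
    { arrows := fun V f => (C.presheaf.map f.op).hom s = 0
      downward_closed := fun {V W} f hf g => by
        rw [op_comp, C.presheaf.map_comp]
        exact (congrArg (C.presheaf.map g.op).hom hf).trans (map_zero _) }
  refine hsep (unop U) S (fun x hx => ?_) _ _ fun V f hf => ?_
  · obtain ⟨V, f, hV, hf⟩ := h x hx
    exact ⟨unop V, f.unop, hf, hV⟩
  · exact hf.trans (map_zero (C.presheaf.map f.op).hom).symm

end Sheafify

/-- A morphism is locally surjective. -/
def AlgPresheaf.Hom.LocSurj {A B : AlgPresheaf X} (f : AlgPresheaf.Hom A B) : Prop :=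
  ∀ (U : (Opens X)ᵒᵖ) (b : B.presheaf.obj U), ∀ x ∈ unop U, ∃ (V : (Opens X)ᵒᵖ) (i : U ⟶ V),
    x ∈ unop V ∧ ∃ a, f.app V a = (B.presheaf.map i).hom b

namespace AlgPresheaf.Hom.LocSurj

variable {A B C : AlgPresheaf X} {f : AlgPresheaf.Hom A B} {g : AlgPresheaf.Hom B C}

lemma toSheaf (A : AlgPresheaf X) : A.toSheaf.LocSurj := by
  intro U b x hx
  obtain ⟨V, i, ⟨a, ha⟩, hV⟩ := Presheaf.imageSieve_mem (Opens.grothendieckTopology X)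
    (CategoryTheory.toSheafify (Opens.grothendieckTopology X) A.presheaf) b x hx
  exact ⟨op V, i.op, hV, a, ha⟩

lemma of_surjective (h : ∀ U, Function.Surjective (f.app U)) : f.LocSurj := fun U _ _ hx =>
  ⟨U, 𝟙 U, hx, h U _⟩

lemma comp (hf : f.LocSurj) (hg : g.LocSurj) : (f.comp g).LocSurj := by
  intro U c x hx
  obtain ⟨V, i, hV, b, hb⟩ := hg U c x hx
  obtain ⟨W, j, hW, a, ha⟩ := hf V b x hV
  refine ⟨W, i ≫ j, hW, a, ?_⟩
  rw [comp_app, ha, app_map, hb, C.presheaf.map_comp]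
  rfl

/-- The commutator vanishes wherever `b` lifts through `f`, hence locally, hence in the sheaf `C`.
-/
lemma commute {C : AlgSheaf X} (hf : f.LocSurj) (g : AlgPresheaf.Hom B C.toAlgPresheaf)
    {D : AlgPresheaf X} (k : AlgPresheaf.Hom D C.toAlgPresheaf)
    (h : ∀ U a d, Commute (g.app U (f.app U a)) (k.app U d)) (U b d) :
    Commute (g.app U b) (k.app U d) := by
  refine sub_eq_zero.1 (C.eq_zero_of_locally _ fun x hx => ?_)
  obtain ⟨V, i, hV, a, ha⟩ := hf U b x hx
  refine ⟨V, i, hV, ?_⟩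
  rw [map_sub, map_mul, map_mul, ← g.app_map, ← k.app_map, ← ha, (h V a _).eq, sub_self]

/-- Locally each section of `B` comes from `A`, where the two morphisms agree; separatedness of `C`
makes the agreement global. -/
lemma epi {C : AlgSheaf X} (hf : f.LocSurj) {g k : AlgPresheaf.Hom B C.toAlgPresheaf}
    (h : f.comp g = f.comp k) : g = k := by
  refine ext_app fun U b => sub_eq_zero.1 (C.eq_zero_of_locally _ fun x hx => ?_)
  obtain ⟨V, i, hV, a, ha⟩ := hf U b x hx
  refine ⟨V, i, hV, ?_⟩
  rw [map_sub, ← g.app_map, ← k.app_map, ← ha, ← comp_app, h, comp_app, sub_self]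

end AlgPresheaf.Hom.LocSurj

/-! ### Quotients -/

section Quotient

/-- A morphism kills a family of sections. -/
def AlgPresheaf.Hom.Kills {A C : AlgPresheaf X} (f : AlgPresheaf.Hom A C)
    (S : ∀ U : (Opens X)ᵒᵖ, Set (A.presheaf.obj U)) : Prop :=
  ∀ U, ∀ s ∈ S U, f.app U s = 0

/-- The sections of a presheaf of ideals. -/
def IdealPresheaf.sections {A : AlgPresheaf X} (I : IdealPresheaf A) (U : (Opens X)ᵒᵖ) :
    Set (A.presheaf.obj U) := I.ideal U

lemma IdealPresheaf.mem_sheafify {A : AlgSheaf X} {I : IdealPresheaf A.toAlgPresheaf}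
    {U : (Opens X)ᵒᵖ} {s : A.presheaf.obj U} :
    s ∈ I.sheafify.ideal U ↔ ∀ x ∈ unop U, ∃ (V : (Opens X)ᵒᵖ) (f : U ⟶ V), x ∈ unop V ∧
      (A.presheaf.map f).hom s ∈ I.ideal V := by
  dsimp only [IdealPresheaf.sheafify]
  rw [TwoSidedIdeal.mem_mk']
  rfl

namespace AlgPresheaf.Hom

lemma _root_.TwoSidedIdeal.le_ker_iff {R S : Type*} [Ring R] [Ring S] (f : R →+* S)
    (I : TwoSidedIdeal R) : I ≤ TwoSidedIdeal.ker f ↔ ∀ x ∈ I, f x = 0 :=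
  ⟨fun h _ hx => (TwoSidedIdeal.mem_ker f).1 (h hx),
    fun h _ hx => (TwoSidedIdeal.mem_ker f).2 (h _ hx)⟩

variable {A C : AlgPresheaf X} {f : AlgPresheaf.Hom A C}

/-- The kernel on sections is a two-sided ideal, and by naturality it contains the restrictions of
the given sections. -/
lemma kills_span {S : ∀ U : (Opens X)ᵒᵖ, Set (A.presheaf.obj U)} (h : f.Kills S) :
    f.Kills (IdealPresheaf.span A S).sections := by
  intro U
  refine (TwoSidedIdeal.le_ker_iff (f.app U).toRingHom _).1 ?_
  refine TwoSidedIdeal.span_le.2 ?_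
  rintro _ ⟨V, i, t, ht, rfl⟩
  refine (TwoSidedIdeal.mem_ker _).2 ((f.app_map i t).trans ?_)
  rw [h V t ht, map_zero]

lemma kills_add {I J : IdealPresheaf A} (hI : f.Kills I.sections) (hJ : f.Kills J.sections) :
    f.Kills (I.add J).sections := by
  intro U
  refine (TwoSidedIdeal.le_ker_iff (f.app U).toRingHom _).1 (sup_le ?_ ?_)
  · exact (TwoSidedIdeal.le_ker_iff _ _).2 (hI U)
  · exact (TwoSidedIdeal.le_ker_iff _ _).2 (hJ U)

/-- A morphism into a sheaf cannot distinguish an ideal presheaf from its sheafification, since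
vanishing in the target is local. -/
lemma kills_sheafify {A C : AlgSheaf X} {f : AlgPresheaf.Hom A.toAlgPresheaf C.toAlgPresheaf}
    {I : IdealPresheaf A.toAlgPresheaf} (h : f.Kills I.sections) :
    f.Kills I.sheafify.sections := by
  intro U s hs
  refine C.eq_zero_of_locally _ fun x hx => ?_
  obtain ⟨V, i, hV, hi⟩ := IdealPresheaf.mem_sheafify.1 hs x hx
  exact ⟨V, i, hV, (f.app_map i s).symm.trans (h V _ hi)⟩

/-- The universal property of a quotient. -/
def quotientLift {I : IdealPresheaf A} (f : AlgPresheaf.Hom A C) (h : f.Kills I.sections) :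
    AlgPresheaf.Hom (A.quotient I) C where
  nat :=
    { app := fun U => RingCat.ofHom ((I.ideal U).ringCon.lift (f.nat.app U).hom (by
        intro s t hst
        rw [TwoSidedIdeal.rel_iff] at hst
        exact sub_eq_zero.1 ((map_sub (f.app U) s t).symm.trans (h U _ hst))))
      naturality := fun U V i => by
        refine RingCat.hom_ext (RingHom.ext fun x => ?_)
        obtain ⟨s, rfl⟩ := (I.ideal U).ringCon.mk'_surjective x
        exact f.app_map i s }
  unit_nat := NatTrans.ext (funext fun U => NatTrans.congr_app f.unit_nat U)

/-- The projection to a quotient. -/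
def _root_.TwistedPathAlgebra.AlgPresheaf.toQuotient (A : AlgPresheaf X) (I : IdealPresheaf A) :
    AlgPresheaf.Hom A (A.quotient I) := ⟨A.quotientMap I, rfl⟩

lemma toQuotient_kills (I : IdealPresheaf A) : (A.toQuotient I).Kills I.sections := by
  intro U s hs
  refine ((RingCon.eq _).2 ?_).trans (map_zero (I.ideal U).ringCon.mk')
  exact (TwoSidedIdeal.mem_iff _ _).1 hs

end AlgPresheaf.Hom

/-- A morphism of sheaves of algebras is the quotient by a family of local sections. -/
structure Presents {A B : AlgSheaf X} (π : AlgPresheaf.Hom A.toAlgPresheaf B.toAlgPresheaf)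
    (S : ∀ U : (Opens X)ᵒᵖ, Set (A.presheaf.obj U)) : Prop where
  kills : π.Kills S
  desc (C : AlgSheaf X) (f : AlgPresheaf.Hom A.toAlgPresheaf C.toAlgPresheaf) (hf : f.Kills S) :
    ∃ g : AlgPresheaf.Hom B.toAlgPresheaf C.toAlgPresheaf, π.comp g = f
  -- This supplies uniqueness in `desc`, through `LocSurj.epi`, and lets commutation in `B` be
  -- tested on the image of `A`.
  locSurj : π.LocSurj

/-- Allows the case without relations to use the path algebras themselves instead of their quotients
by zero. -/
lemma presents_id (A : AlgSheaf X) {S : ∀ U : (Opens X)ᵒᵖ, Set (A.presheaf.obj U)}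
    (hS : ∀ U, S U = ∅) : Presents (.id A.toAlgPresheaf) S where
  kills U s hs := by simp [hS] at hs
  desc C f _ := ⟨f, rfl⟩
  locSurj := .of_surjective fun _ b => ⟨b, rfl⟩

/-- The projection to the quotient sheaf. -/
def AlgSheaf.toQuotient (A : AlgSheaf X) (I : IdealPresheaf A.toAlgPresheaf) :
    AlgPresheaf.Hom A.toAlgPresheaf (A.quotient I).toAlgPresheaf :=
  (A.toAlgPresheaf.toQuotient I).comp (A.toAlgPresheaf.quotient I).toSheaf

/-- The hypothesis `hI` expresses that `S` generates `I` as far as morphisms into sheaves can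
detect, so spans, sums and sheafifications of ideals are all covered. -/
lemma presents_quotient (A : AlgSheaf X) (I : IdealPresheaf A.toAlgPresheaf)
    {S : ∀ U : (Opens X)ᵒᵖ, Set (A.presheaf.obj U)} (hS : ∀ U, S U ⊆ I.ideal U)
    (hI : ∀ (C : AlgSheaf X) (f : AlgPresheaf.Hom A.toAlgPresheaf C.toAlgPresheaf),
      f.Kills S → f.Kills I.sections) :
    Presents (A.toQuotient I) S where
  kills U s hs := (congrArg ((A.toAlgPresheaf.quotient I).toSheaf.app U)
    (AlgPresheaf.Hom.toQuotient_kills I U s (hS U hs))).trans (map_zero _)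
  desc C f hf := ⟨(f.quotientLift (hI C f hf)).sheafLift,
    congrArg (AlgPresheaf.Hom.comp _) (AlgPresheaf.Hom.toSheaf_comp_sheafLift _)⟩
  locSurj := .comp (.of_surjective fun U => (I.ideal U).ringCon.mk'_surjective) (.toSheaf _)

end Quotient

/-! ### Tensor products -/

section Tensor

variable (A B : AlgPresheaf X)

/-- The morphism `a ↦ a ⊗ 1`. -/
def AlgPresheaf.inclLeft : AlgPresheaf.Hom A (A.tensor B) :=
  .mk' (fun U => (Algebra.TensorProduct.includeLeftRingHom :
      A.presheaf.obj U →+* A.presheaf.obj U ⊗[X.presheaf.obj U] B.presheaf.obj U))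
    (fun U r => rfl)
    fun U V i s => by
      refine Eq.trans ?_ (tensorMap_tmul _ _ _ (A.map_algebraMap i) (B.map_algebraMap i) s 1).symm
      rw [map_one]
      rfl

/-- The morphism `b ↦ 1 ⊗ b`. -/
def AlgPresheaf.inclRight : AlgPresheaf.Hom B (A.tensor B) :=
  .mk' (fun U => (Algebra.TensorProduct.includeRight :
      B.presheaf.obj U →ₐ[X.presheaf.obj U]
        A.presheaf.obj U ⊗[X.presheaf.obj U] B.presheaf.obj U).toRingHom)
    (fun U r => (Algebra.TensorProduct.includeRight :
      B.presheaf.obj U →ₐ[X.presheaf.obj U]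
        A.presheaf.obj U ⊗[X.presheaf.obj U] B.presheaf.obj U).commutes r)
    fun U V i s => by
      refine Eq.trans ?_ (tensorMap_tmul _ _ _ (A.map_algebraMap i) (B.map_algebraMap i) 1 s).symm
      rw [map_one]
      rfl

variable {A B} {C : AlgPresheaf X}

lemma AlgPresheaf.commute_incl (U : (Opens X)ᵒᵖ) (a : A.presheaf.obj U) (b : B.presheaf.obj U) :
    Commute ((A.inclLeft B).app U a) ((A.inclRight B).app U b) := by
  have h : a ⊗ₜ[X.presheaf.obj U] (1 : B.presheaf.obj U) * (1 : A.presheaf.obj U) ⊗ₜ b =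
      (1 : A.presheaf.obj U) ⊗ₜ b * a ⊗ₜ[X.presheaf.obj U] (1 : B.presheaf.obj U) := by simp
  exact h

/-- The universal property of the tensor product. -/
def AlgPresheaf.Hom.tensorLift (f : AlgPresheaf.Hom A C) (g : AlgPresheaf.Hom B C)
    (h : ∀ U a b, Commute (f.app U a) (g.app U b)) : AlgPresheaf.Hom (A.tensor B) C :=
  .mk' (fun U => (Algebra.TensorProduct.lift (f.app U) (g.app U) (h U)).toRingHom)
    (fun U r => (Algebra.TensorProduct.lift (f.app U) (g.app U) (h U)).commutes r)
    fun U V i s => by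
      change Algebra.TensorProduct.lift (f.app V) (g.app V) (h V)
        (tensorMap _ _ _ (A.map_algebraMap i) (B.map_algebraMap i) s) =
        (C.presheaf.map i).hom (Algebra.TensorProduct.lift (f.app U) (g.app U) (h U) s)
      induction s using TensorProduct.induction_on with
      | zero => simp only [map_zero]
      | tmul a b =>
        rw [tensorMap_tmul, Algebra.TensorProduct.lift_tmul, Algebra.TensorProduct.lift_tmul,
          f.app_map, g.app_map, map_mul]
      | add x y hx hy => simp only [map_add, hx, hy]

lemma AlgPresheaf.Hom.inclLeft_comp_tensorLift (f : AlgPresheaf.Hom A C) (g : AlgPresheaf.Hom B C)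
    (h : ∀ U a b, Commute (f.app U a) (g.app U b)) :
    (A.inclLeft B).comp (f.tensorLift g h) = f := by
  refine ext_app fun U s => ?_
  change Algebra.TensorProduct.lift (f.app U) (g.app U) (h U) (s ⊗ₜ 1) = _
  simp

lemma AlgPresheaf.Hom.inclRight_comp_tensorLift (f : AlgPresheaf.Hom A C)
    (g : AlgPresheaf.Hom B C) (h : ∀ U a b, Commute (f.app U a) (g.app U b)) :
    (A.inclRight B).comp (f.tensorLift g h) = g := by
  refine ext_app fun U s => ?_
  change Algebra.TensorProduct.lift (f.app U) (g.app U) (h U) (1 ⊗ₜ s) = _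
  simp

lemma AlgPresheaf.Hom.tensor_ext {f g : AlgPresheaf.Hom (A.tensor B) C}
    (hl : (A.inclLeft B).comp f = (A.inclLeft B).comp g)
    (hr : (A.inclRight B).comp f = (A.inclRight B).comp g) : f = g := by
  refine ext_app fun U s => ?_
  have hl' (a : A.presheaf.obj U) : f.app U (a ⊗ₜ[X.presheaf.obj U] (1 : B.presheaf.obj U)) =
      g.app U (a ⊗ₜ[X.presheaf.obj U] (1 : B.presheaf.obj U)) :=
    congrArg (fun k => app k U a) hl
  have hr' (b : B.presheaf.obj U) : f.app U ((1 : A.presheaf.obj U) ⊗ₜ[X.presheaf.obj U] b) =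
      g.app U ((1 : A.presheaf.obj U) ⊗ₜ[X.presheaf.obj U] b) :=
    congrArg (fun k => app k U b) hr
  refine TensorProduct.induction_on (motive := fun s => f.app U s = g.app U s) s
    ((map_zero (f.app U)).trans (map_zero (g.app U)).symm) (fun a b => ?_) fun x y hx hy => ?_
  -- Pure tensors are products of elements from the two factors, so a multiplicative map is
  -- determined on the factors.
  · have e : (a ⊗ₜ[X.presheaf.obj U] b : A.presheaf.obj U ⊗[X.presheaf.obj U] B.presheaf.obj U) =
      a ⊗ₜ[X.presheaf.obj U] 1 * 1 ⊗ₜ[X.presheaf.obj U] b := by simp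
    rw [e]
    refine (map_mul (f.app U) _ _).trans (Eq.trans ?_ (map_mul (g.app U) _ _).symm)
    rw [hl', hr']
  · refine (map_add (f.app U) _ _).trans (Eq.trans ?_ (map_add (g.app U) _ _).symm)
    rw [hx, hy]

/-- The morphism `a ↦ a ⊗ 1` of sheaves. -/
def AlgSheaf.inclLeft (A B : AlgSheaf X) :
    AlgPresheaf.Hom A.toAlgPresheaf (A.tensor B).toAlgPresheaf :=
  (A.toAlgPresheaf.inclLeft B.toAlgPresheaf).comp (AlgPresheaf.toSheaf _)

/-- The morphism `b ↦ 1 ⊗ b` of sheaves. -/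
def AlgSheaf.inclRight (A B : AlgSheaf X) :
    AlgPresheaf.Hom B.toAlgPresheaf (A.tensor B).toAlgPresheaf :=
  (A.toAlgPresheaf.inclRight B.toAlgPresheaf).comp (AlgPresheaf.toSheaf _)

lemma AlgSheaf.commute_incl {A B : AlgSheaf X} (U : (Opens X)ᵒᵖ) (a : A.presheaf.obj U)
    (b : B.presheaf.obj U) : Commute ((A.inclLeft B).app U a) ((A.inclRight B).app U b) :=
  (AlgPresheaf.commute_incl (A := A.toAlgPresheaf) (B := B.toAlgPresheaf) U a b).map
    ((A.toAlgPresheaf.tensor B.toAlgPresheaf).toSheaf.app U)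

/-- The universal property of the tensor product of sheaves. -/
lemma AlgSheaf.tensor_desc {A B C : AlgSheaf X}
    (f : AlgPresheaf.Hom A.toAlgPresheaf C.toAlgPresheaf)
    (g : AlgPresheaf.Hom B.toAlgPresheaf C.toAlgPresheaf)
    (h : ∀ U a b, Commute (f.app U a) (g.app U b)) :
    ∃ k : AlgPresheaf.Hom (A.tensor B).toAlgPresheaf C.toAlgPresheaf,
      (A.inclLeft B).comp k = f ∧ (A.inclRight B).comp k = g := by
  have e := AlgPresheaf.Hom.toSheaf_comp_sheafLift (f.tensorLift g h)
  refine ⟨(f.tensorLift g h).sheafLift, ?_, ?_⟩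
  · exact (congrArg (fun k => (A.toAlgPresheaf.inclLeft B.toAlgPresheaf).comp k) e).trans
      (f.inclLeft_comp_tensorLift g h)
  · exact (congrArg (fun k => (A.toAlgPresheaf.inclRight B.toAlgPresheaf).comp k) e).trans
      (f.inclRight_comp_tensorLift g h)

lemma AlgSheaf.tensor_ext {A B C : AlgSheaf X}
    {f g : AlgPresheaf.Hom (A.tensor B).toAlgPresheaf C.toAlgPresheaf}
    (hl : (A.inclLeft B).comp f = (A.inclLeft B).comp g)
    (hr : (A.inclRight B).comp f = (A.inclRight B).comp g) : f = g :=
  AlgPresheaf.Hom.sheafify_ext (AlgPresheaf.Hom.tensor_ext hl hr)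

end Tensor

end SheafHom

end TwistedPathAlgebra
end

noncomputable section

namespace TwistedPathAlgebra

/-! ### Representations in presheaves of algebras and the universal property of the path algebra. -/

section SheafRep

variable {X : RingedSpace.{u, u}}

/-- A representation of a twisted quiver in a presheaf of algebras. -/
structure SheafRep (Q : FinQuiver.{u}) (M : Q.E → SheafOfModules.{u} (structureSheaf X))
    (C : AlgPresheaf X) where
  /-- the representation on sections -/
  rep (U : (Opens X)ᵒᵖ) :
    Rep (X.presheaf.obj U) Q (fun a => Sec (M a) U) (C.presheaf.obj U)
  map_vert {U V : (Opens X)ᵒᵖ} (f : U ⟶ V) (i : Q.V) :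
    (C.presheaf.map f).hom ((rep U).vert i) = (rep V).vert i
  map_arrow {U V : (Opens X)ᵒᵖ} (f : U ⟶ V) (a : Q.E) (m : Sec (M a) U) :
    (C.presheaf.map f).hom ((rep U).arrow a m) = (rep V).arrow a (secMap (M a) f m)

namespace SheafRep

variable {Q : FinQuiver.{u}} {M : Q.E → SheafOfModules.{u} (structureSheaf X)}
  {C D E : AlgPresheaf X}

lemma ext_rep {ρ τ : SheafRep Q M C} (h : ∀ U, ρ.rep U = τ.rep U) : ρ = τ := by
  cases ρ; cases τ
  congr 1
  exact funext h

/-- The image of a representation under a morphism. -/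
def push (ρ : SheafRep Q M C) (f : AlgPresheaf.Hom C D) : SheafRep Q M D where
  rep U := (ρ.rep U).map (f.app U)
  map_vert i v := (f.app_map i _).symm.trans (congrArg _ (ρ.map_vert i v))
  map_arrow i a m := (f.app_map i _).symm.trans (congrArg _ (ρ.map_arrow i a m))

lemma push_comp (ρ : SheafRep Q M C) (f : AlgPresheaf.Hom C D) (g : AlgPresheaf.Hom D E) :
    ρ.push (f.comp g) = (ρ.push f).push g := rfl

variable (Q M) in
/-- The tautological representation in the presheaf path algebra. -/
def canonical : SheafRep Q M (pathAlgPresheaf Q M) where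
  -- Mapping along the identity passes from the algebra structure of `PathAlg` to the one induced by
  -- the unit of the presheaf; the two agree definitionally.
  rep U := (Rep.canonical (X.presheaf.obj U) Q (fun a => Sec (M a) U)).map
    (B := (pathAlgPresheaf Q M).presheaf.obj U)
    { RingHom.id (PathAlg (X.presheaf.obj U) Q (fun a => Sec (M a) U)) with
      commutes' := fun _ => rfl }
  map_vert f i := PathAlg.map_vert (X.presheaf.map f).hom (fun a => secMap (M a) f) i
  map_arrow f a m := PathAlg.map_arrow (X.presheaf.map f).hom (fun a => secMap (M a) f) a m

/-- The morphism from the presheaf path algebra given by a representation. -/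
def presheafDesc (ρ : SheafRep Q M C) : AlgPresheaf.Hom (pathAlgPresheaf Q M) C :=
  .mk' (fun U => (ρ.rep U).lift.toRingHom) (fun U r => (ρ.rep U).lift.commutes r)
    fun U V f s => by
      -- Restriction changes the base ring, so naturality is compared as an equality of ring
      -- morphisms, with scalars checked separately.
      refine RingHom.congr_fun (f := (ρ.rep V).lift.toRingHom.comp (PathAlg.map (X.presheaf.map f).hom
        fun a => secMap (M a) f)) (g := (C.presheaf.map f).hom.comp (ρ.rep U).lift.toRingHom)
        (PathAlg.ringHom_ext' (fun r => ?_) (fun i => ?_) fun a m => ?_) s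
      · change (ρ.rep V).lift (PathAlg.map _ _ _) = (C.presheaf.map f).hom ((ρ.rep U).lift _)
        rw [PathAlg.map_algebraMap, AlgHom.commutes, AlgHom.commutes, C.map_algebraMap]
      · change (ρ.rep V).lift (PathAlg.map _ _ _) = (C.presheaf.map f).hom ((ρ.rep U).lift _)
        rw [PathAlg.map_vert, Rep.lift_vert, Rep.lift_vert, ρ.map_vert]
      · change (ρ.rep V).lift (PathAlg.map _ _ _) = (C.presheaf.map f).hom ((ρ.rep U).lift _)
        rw [PathAlg.map_arrow, Rep.lift_arrow, Rep.lift_arrow, ρ.map_arrow]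

lemma canonical_push_presheafDesc (ρ : SheafRep Q M C) :
    (canonical Q M).push ρ.presheafDesc = ρ :=
  ext_rep fun U => Rep.ext (funext fun i => (ρ.rep U).lift_vert i)
    (funext fun a => LinearMap.ext fun m => (ρ.rep U).lift_arrow a m)

lemma presheaf_hom_ext {f g : AlgPresheaf.Hom (pathAlgPresheaf Q M) C}
    (h : (canonical Q M).push f = (canonical Q M).push g) : f = g := by
  refine AlgPresheaf.Hom.ext_app fun U s => ?_
  refine RingHom.congr_fun (f := (f.app U).toRingHom) (g := (g.app U).toRingHom)
    (PathAlg.ringHom_ext' (fun r => ?_) (fun i => ?_) fun a m => ?_) s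
  · exact ((f.app U).commutes r).trans ((g.app U).commutes r).symm
  · exact congrArg (fun ρ => (ρ.rep U).vert i) h
  · exact congrArg (fun ρ => (ρ.rep U).arrow a m) h

variable (Q M) in
/-- The canonical morphism from the presheaf path algebra to the path algebra. -/
def _root_.TwistedPathAlgebra.toPathAlgebra :
    AlgPresheaf.Hom (pathAlgPresheaf Q M) (pathAlgebra Q M).toAlgPresheaf :=
  (pathAlgPresheaf Q M).toSheaf

lemma _root_.TwistedPathAlgebra.locSurj_toPathAlgebra : (toPathAlgebra Q M).LocSurj :=
  .toSheaf _

variable (Q M) in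
/-- The tautological representation in the path algebra. -/
def univ : SheafRep Q M (pathAlgebra Q M).toAlgPresheaf :=
  (canonical Q M).push (toPathAlgebra Q M)

/-- Expresses sheafification on sections as the lift of a representation, so that the results over a
ring apply. -/
lemma toPathAlgebra_app (U : (Opens X)ᵒᵖ) (s : PathAlg (X.presheaf.obj U) Q fun a => Sec (M a) U) :
    (toPathAlgebra Q M).app U s = ((univ Q M).rep U).lift s := by
  refine RingHom.congr_fun (f := ((toPathAlgebra Q M).app U).toRingHom)
    (g := ((univ Q M).rep U).lift.toRingHom)
    (PathAlg.ringHom_ext' (fun r => ?_) (fun i => ?_) fun a m => ?_) s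
  · exact (((toPathAlgebra Q M).app U).commutes r).trans (((univ Q M).rep U).lift.commutes r).symm
  · exact (((univ Q M).rep U).lift_vert i).symm
  · exact (((univ Q M).rep U).lift_arrow a m).symm

section Desc

variable {C D : AlgSheaf X}

/-- The morphism from the path algebra given by a representation in a sheaf of algebras. -/
def desc (ρ : SheafRep Q M C.toAlgPresheaf) :
    AlgPresheaf.Hom (pathAlgebra Q M).toAlgPresheaf C.toAlgPresheaf :=
  ρ.presheafDesc.sheafLift

lemma toPathAlgebra_comp_desc (ρ : SheafRep Q M C.toAlgPresheaf) :
    (toPathAlgebra Q M).comp ρ.desc = ρ.presheafDesc :=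
  ρ.presheafDesc.toSheaf_comp_sheafLift

lemma desc_toPathAlgebra (ρ : SheafRep Q M C.toAlgPresheaf) (U : (Opens X)ᵒᵖ)
    (s : PathAlg (X.presheaf.obj U) Q fun a => Sec (M a) U) :
    ρ.desc.app U ((toPathAlgebra Q M).app U s) = (ρ.rep U).lift s :=
  ρ.presheafDesc.sheafLift_toSheaf U s

/-- With `hom_ext`, this is the universal property: morphisms from the path algebra to a sheaf of
algebras correspond to representations. -/
lemma univ_push_desc (ρ : SheafRep Q M C.toAlgPresheaf) : (univ Q M).push ρ.desc = ρ :=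
  (congrArg (canonical Q M).push ρ.toPathAlgebra_comp_desc).trans ρ.canonical_push_presheafDesc

lemma hom_ext {f g : AlgPresheaf.Hom (pathAlgebra Q M).toAlgPresheaf C.toAlgPresheaf}
    (h : (univ Q M).push f = (univ Q M).push g) : f = g :=
  AlgPresheaf.Hom.sheafify_ext (presheaf_hom_ext h)

lemma desc_comp (ρ : SheafRep Q M C.toAlgPresheaf)
    (f : AlgPresheaf.Hom C.toAlgPresheaf D.toAlgPresheaf) :
    ρ.desc.comp f = (ρ.push f).desc :=
  hom_ext (by rw [push_comp, univ_push_desc, univ_push_desc])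

lemma desc_univ_push (f : AlgPresheaf.Hom (pathAlgebra Q M).toAlgPresheaf C.toAlgPresheaf) :
    ((univ Q M).push f).desc = f :=
  hom_ext (univ_push_desc _)

end Desc

end SheafRep

end SheafRep

/-! ### Representations of the tensor quiver in presheaves of algebras. -/

section Tensor

open FinQuiver

variable {X : RingedSpace.{u, u}} {Q' Q'' : FinQuiver.{u}}
  {M' : Q'.E → SheafOfModules.{u} (structureSheaf X)}
  {M'' : Q''.E → SheafOfModules.{u} (structureSheaf X)}

variable (M' M'') in
/-- The identification `M'_α = M_(α,j)` on sections. -/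
def twistLeft (U : (Opens X)ᵒᵖ) (α : Q'.E) (j : Q''.V) :
    Sec (M' α) U ≃ₗ[X.presheaf.obj U] Sec (tensorTwist M' M'' (tensorLeft α j)) U :=
  LinearEquiv.refl (X.presheaf.obj U) (Sec (M' α) U)

variable (M' M'') in
/-- The identification `M''_β = M_(i,β)` on sections. -/
def twistRight (U : (Opens X)ᵒᵖ) (i : Q'.V) (β : Q''.E) :
    Sec (M'' β) U ≃ₗ[X.presheaf.obj U] Sec (tensorTwist M' M'' (tensorRight i β)) U :=
  LinearEquiv.refl (X.presheaf.obj U) (Sec (M'' β) U)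

namespace SheafRep

variable {C D : AlgPresheaf X}

/-- The representation of the first factor underlying a representation of a tensor quiver. -/
def left (σ : SheafRep (Q'.tensor Q'') (tensorTwist M' M'') C) : SheafRep Q' M' C where
  rep U := Rep.left (twistLeft M' M'' U) (σ.rep U)
  map_vert f i := by
    simp only [Rep.left_vert, map_sum, σ.map_vert]
  map_arrow f a m := by
    simp only [Rep.left_arrow, map_sum, σ.map_arrow]
    rfl

/-- The representation of the second factor underlying a representation of a tensor quiver. -/
def right (σ : SheafRep (Q'.tensor Q'') (tensorTwist M' M'') C) : SheafRep Q'' M'' C where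
  rep U := Rep.right (twistRight M' M'' U) (σ.rep U)
  map_vert f i := by
    simp only [Rep.right_vert, map_sum, σ.map_vert]
  map_arrow f a m := by
    simp only [Rep.right_arrow, map_sum, σ.map_arrow]
    rfl

lemma left_push (σ : SheafRep (Q'.tensor Q'') (tensorTwist M' M'') C)
    (f : AlgPresheaf.Hom C D) : (σ.push f).left = σ.left.push f :=
  ext_rep fun U => Rep.left_map (σ.rep U) (f.app U)

lemma right_push (σ : SheafRep (Q'.tensor Q'') (tensorTwist M' M'') C)
    (f : AlgPresheaf.Hom C D) : (σ.push f).right = σ.right.push f :=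
  ext_rep fun U => Rep.right_map (σ.rep U) (f.app U)

/-- Two representations commute if they do so on sections. -/
def Commutes (ρ : SheafRep Q' M' C) (τ : SheafRep Q'' M'' C) : Prop :=
  ∀ U, (ρ.rep U).Commutes (τ.rep U)

/-- The representation of the tensor quiver given by two commuting representations. -/
def tensor {ρ : SheafRep Q' M' C} {τ : SheafRep Q'' M'' C} (h : Commutes ρ τ) :
    SheafRep (Q'.tensor Q'') (tensorTwist M' M'') C where
  rep U := Rep.tensor (twistLeft M' M'' U) (twistRight M' M'' U) (h U)
  map_vert f x := by
    induction x using tensorVert_cases with | h i j => ?_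
    rw [Rep.tensor_vert, Rep.tensor_vert, map_mul, ρ.map_vert, τ.map_vert]
  map_arrow f a m := by
    induction a using tensorEdgeRec with
    | left α j =>
      rw [Rep.tensor_arrow_left, Rep.tensor_arrow_left, map_mul, ρ.map_arrow, τ.map_vert]
      rfl
    | right i β =>
      rw [Rep.tensor_arrow_right, Rep.tensor_arrow_right, map_mul, ρ.map_vert, τ.map_arrow]
      rfl

/-- The commutation relations of a tensor quiver hold in a representation. -/
def IsComm (σ : SheafRep (Q'.tensor Q'') (tensorTwist M' M'') C) : Prop :=
  ∀ U, Rep.IsComm (twistLeft M' M'' U) (twistRight M' M'' U) (σ.rep U)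

lemma IsComm.push {σ : SheafRep (Q'.tensor Q'') (tensorTwist M' M'') C} (h : σ.IsComm)
    (f : AlgPresheaf.Hom C D) : (σ.push f).IsComm := fun U => (h U).map (f.app U)

section Tensor

variable {ρ : SheafRep Q' M' C} {τ : SheafRep Q'' M'' C} (h : Commutes ρ τ)

lemma isComm_tensor : (tensor h).IsComm := fun U => Rep.isComm_tensor (h U)

lemma left_tensor : (tensor h).left = ρ := ext_rep fun U => Rep.left_tensor (h U)

lemma right_tensor : (tensor h).right = τ := ext_rep fun U => Rep.right_tensor (h U)

end Tensor

lemma commutes_left_right {σ : SheafRep (Q'.tensor Q'') (tensorTwist M' M'') C}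
    (h : σ.IsComm) : Commutes σ.left σ.right := fun U => Rep.commutes_left_right (h U)

lemma ext_left_right {σ σ' : SheafRep (Q'.tensor Q'') (tensorTwist M' M'') C} (h : σ.IsComm)
    (h' : σ'.IsComm) (hl : σ.left = σ'.left) (hr : σ.right = σ'.right) : σ = σ' :=
  ext_rep fun U => Rep.ext_left_right (h U) (h' U) (congrArg (fun ρ => ρ.rep U) hl)
    (congrArg (fun ρ => ρ.rep U) hr)

/-- Local surjectivity of sheafification replaces one argument at a time by an element of a presheaf
path algebra; there `Rep.Commutes.lift` applies. -/
lemma Commutes.desc {C : AlgSheaf X} {ρ : SheafRep Q' M' C.toAlgPresheaf}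
    {τ : SheafRep Q'' M'' C.toAlgPresheaf} (h : Commutes ρ τ) (U a b) :
    Commute (ρ.desc.app U a) (τ.desc.app U b) := by
  refine (locSurj_toPathAlgebra (Q := Q') (M := M')).commute ρ.desc τ.desc
    (fun U a b => Commute.symm ?_) U a b
  refine (locSurj_toPathAlgebra (Q := Q'') (M := M'')).commute τ.desc
    ((toPathAlgebra Q' M').comp ρ.desc) (fun U b a => ?_) U b a
  exact (congrArg₂ Commute (τ.desc_toPathAlgebra U b) (ρ.desc_toPathAlgebra U a)).mpr
    ((h U).lift a b).symm

lemma commutes_of_commute {A B : AlgPresheaf X} (ρ : SheafRep Q' M' A) (τ : SheafRep Q'' M'' B)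
    (f : AlgPresheaf.Hom A C) (g : AlgPresheaf.Hom B C)
    (h : ∀ U a b, Commute (f.app U a) (g.app U b)) : Commutes (ρ.push f) (τ.push g) :=
  fun U => ⟨fun _ _ => h U _ _, fun _ _ _ => h U _ _, fun _ _ _ => h U _ _,
    fun _ _ _ _ => h U _ _⟩

end SheafRep

end Tensor

end TwistedPathAlgebra
end

noncomputable section

namespace TwistedPathAlgebra

/-! ### Relations in the tensor quiver and the comparison isomorphism. -/

section Main

open FinQuiver

variable {X : RingedSpace.{u, u}}

section Path

variable {Q : FinQuiver.{u}} {M : Q.E → SheafOfModules.{u} (structureSheaf X)}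

/-- Makes `pathToAlg` computable on presheaf tensors, where it is ordinary multiplication in the
universal representation. -/
lemma toSheafify_pathToAlg (p : Q.Path) (U : (Opens X)ᵒᵖ)
    (x : ⨂[X.presheaf.obj U] k, Sec (M (p.edge k)) U) :
    ((pathToAlg Q M p).app U).hom
      (((CategoryTheory.toSheafify (Opens.grothendieckTopology X)
        (tensorPresheaf fun k => M (p.edge k))).app U).hom x) =
      ((SheafRep.univ Q M).rep U).lift
        (PathAlg.tensorMap (X.presheaf.obj U) Q (fun a => Sec (M a) U) p.edge x) := by
  have h : CategoryTheory.toSheafify (Opens.grothendieckTopology X)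
      (tensorPresheaf fun k => M (p.edge k)) ≫ pathToAlg Q M p =
    pathToAlgPresheaf Q M p ≫ Functor.whiskerRight (pathAlgPresheaf Q M).toSheafify
      (forget₂ RingCat.{u} AddCommGrpCat.{u}) := toSheafify_sheafifyLift _ _ _
  exact (ConcreteCategory.congr_hom (NatTrans.congr_app h U) x).trans
    (SheafRep.toPathAlgebra_app U _)

/-- Additive maps out of the sheaf `M_p` into a sheaf of algebras which commute with restrictions
are determined by their values on pure tensors. -/
lemma pathSheaf_hom_ext (p : Q.Path) {C : AlgSheaf X}
    (f g : ∀ U, (pathSheaf Q M p).obj.obj U →+ C.presheaf.obj U)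
    (hf : ∀ (U V : (Opens X)ᵒᵖ) (i : U ⟶ V) (s : (pathSheaf Q M p).obj.obj U),
      f V (((pathSheaf Q M p).obj.map i).hom s) = (C.presheaf.map i).hom (f U s))
    (hg : ∀ (U V : (Opens X)ᵒᵖ) (i : U ⟶ V) (s : (pathSheaf Q M p).obj.obj U),
      g V (((pathSheaf Q M p).obj.map i).hom s) = (C.presheaf.map i).hom (g U s))
    (h : ∀ (U : (Opens X)ᵒᵖ) (x : ⨂[X.presheaf.obj U] k, Sec (M (p.edge k)) U),
      f U (((CategoryTheory.toSheafify (Opens.grothendieckTopology X)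
        (tensorPresheaf fun k => M (p.edge k))).app U).hom x) =
      g U (((CategoryTheory.toSheafify (Opens.grothendieckTopology X)
        (tensorPresheaf fun k => M (p.edge k))).app U).hom x)) (U s) : f U s = g U s := by
  -- Packaged as natural transformations into a sheaf of abelian groups, the two families are
  -- subject to the uniqueness part of sheafification.
  let toNat (f : ∀ U, (pathSheaf Q M p).obj.obj U →+ C.presheaf.obj U)
      (hf : ∀ (U V : (Opens X)ᵒᵖ) (i : U ⟶ V) (s : (pathSheaf Q M p).obj.obj U),
        f V (((pathSheaf Q M p).obj.map i).hom s) = (C.presheaf.map i).hom (f U s)) :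
      (pathSheaf Q M p).obj ⟶ C.presheaf ⋙ forget₂ RingCat.{u} AddCommGrpCat.{u} :=
    { app := fun U => AddCommGrpCat.ofHom (f U)
      naturality := fun U V i => by
        ext s
        exact hf U V i s }
  have key : toNat f hf = toNat g hg := by
    refine sheafify_hom_ext (Opens.grothendieckTopology X) _ _
      (((sheafCompose (Opens.grothendieckTopology X) (forget₂ RingCat.{u} AddCommGrpCat.{u})).obj
        ⟨_, C.isSheaf⟩).property) ?_
    ext U x
    exact h U x
  exact ConcreteCategory.congr_hom (NatTrans.congr_app key U) s

lemma pathToAlg_map (p : Q.Path) {U V : (Opens X)ᵒᵖ} (i : U ⟶ V)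
    (s : (pathSheaf Q M p).obj.obj U) :
    ((pathToAlg Q M p).app V).hom (((pathSheaf Q M p).obj.map i).hom s) =
      ((pathAlgebra Q M).presheaf.map i).hom (((pathToAlg Q M p).app U).hom s) :=
  ConcreteCategory.congr_hom ((pathToAlg Q M p).naturality i) s

end Path

variable {Q' Q'' : FinQuiver.{u}}
  {M' : Q'.E → SheafOfModules.{u} (structureSheaf X)}
  {M'' : Q''.E → SheafOfModules.{u} (structureSheaf X)}

lemma lift_left_tensorMap {C : AlgPresheaf X}
    (σ : SheafRep (Q'.tensor Q'') (tensorTwist M' M'') C) (p : Q'.Path) {U : (Opens X)ᵒᵖ}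
    (x : ⨂[X.presheaf.obj U] k, Sec (M' (p.edge k)) U) :
    (σ.left.rep U).lift
        (PathAlg.tensorMap (X.presheaf.obj U) Q' (fun a => Sec (M' a) U) p.edge x) =
      ∑ j, (σ.rep U).lift (PathAlg.tensorMap (X.presheaf.obj U) (Q'.tensor Q'')
        (fun a => Sec (tensorTwist M' M'' a) U) (p.left Q'' j).edge x) := by
  induction x using PiTensorProduct.induction_on with
  | smul_tprod r m =>
    exact Rep.left_lift_tensorMap_smul_tprod (R := X.presheaf.obj U)
      (M' := fun a => Sec (M' a) U) (N := fun a => Sec (tensorTwist M' M'' a) U)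
      (l := twistLeft M' M'' U) (σ.rep U) p.pos p.edge r m
  | add x y hx hy =>
    rw [map_add, map_add, hx, hy, ← Finset.sum_add_distrib]
    refine Finset.sum_congr rfl fun j _ => ?_
    rw [← map_add]
    -- Here `x` and `y` are read as tensors along `p.left Q'' j`; the tensor products along the two
    -- paths agree definitionally.
    exact congrArg _ (map_add _ x y).symm

lemma lift_right_tensorMap {C : AlgPresheaf X}
    (σ : SheafRep (Q'.tensor Q'') (tensorTwist M' M'') C) (q : Q''.Path) {U : (Opens X)ᵒᵖ}
    (x : ⨂[X.presheaf.obj U] k, Sec (M'' (q.edge k)) U) :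
    (σ.right.rep U).lift
        (PathAlg.tensorMap (X.presheaf.obj U) Q'' (fun a => Sec (M'' a) U) q.edge x) =
      ∑ i, (σ.rep U).lift (PathAlg.tensorMap (X.presheaf.obj U) (Q'.tensor Q'')
        (fun a => Sec (tensorTwist M' M'' a) U) (q.right Q' i).edge x) := by
  induction x using PiTensorProduct.induction_on with
  | smul_tprod r m =>
    exact Rep.right_lift_tensorMap_smul_tprod (R := X.presheaf.obj U)
      (M'' := fun a => Sec (M'' a) U) (N := fun a => Sec (tensorTwist M' M'' a) U)
      (r := twistRight M' M'' U) (σ.rep U) q.pos q.edge r m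
  | add x y hx hy =>
    rw [map_add, map_add, hx, hy, ← Finset.sum_add_distrib]
    refine Finset.sum_congr rfl fun j _ => ?_
    rw [← map_add]
    exact congrArg _ (map_add _ x y).symm

variable (M' M'') in
/-- The morphism `T_{M'}(Q') → T_M(Q' ⊗ Q'')`. -/
def leftHom : AlgPresheaf.Hom (pathAlgebra Q' M').toAlgPresheaf
    (pathAlgebra (Q'.tensor Q'') (tensorTwist M' M'')).toAlgPresheaf :=
  (SheafRep.univ (Q'.tensor Q'') (tensorTwist M' M'')).left.desc

variable (M' M'') in
/-- The morphism `T_{M''}(Q'') → T_M(Q' ⊗ Q'')`. -/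
def rightHom : AlgPresheaf.Hom (pathAlgebra Q'' M'').toAlgPresheaf
    (pathAlgebra (Q'.tensor Q'') (tensorTwist M' M'')).toAlgPresheaf :=
  (SheafRep.univ (Q'.tensor Q'') (tensorTwist M' M'')).right.desc

/-- Both sides are additive in `s` and commute with restriction, so it suffices to compare them on
presheaf tensors, where `lift_left_tensorMap` gives the sum over `j`. -/
lemma leftHom_pathToAlg (p : Q'.Path) (U : (Opens X)ᵒᵖ) (s : (pathSheaf Q' M' p).obj.obj U) :
    (leftHom M' M'').app U (((pathToAlg Q' M' p).app U).hom s) =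
      ∑ j, ((pathToAlg (Q'.tensor Q'') (tensorTwist M' M'') (p.left Q'' j)).app U).hom s := by
  refine (pathSheaf_hom_ext (C := pathAlgebra (Q'.tensor Q'') (tensorTwist M' M'')) p
    (fun U => ((leftHom M' M'').app U).toRingHom.toAddMonoidHom.comp ((pathToAlg Q' M' p).app U).hom)
    (fun U => ∑ j, ((pathToAlg (Q'.tensor Q'') (tensorTwist M' M'') (p.left Q'' j)).app U).hom)
    (fun U V i s => ?_) (fun U V i s => ?_) (fun U x => ?_) U s).trans
    (AddMonoidHom.finsetSum_apply _ _ s)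
  · exact (congrArg ((leftHom M' M'').app V) (pathToAlg_map p i s)).trans
      ((leftHom M' M'').app_map i _)
  · refine (AddMonoidHom.finsetSum_apply _ _ _).trans (Eq.trans ?_ (congrArg
      ((pathAlgebra (Q'.tensor Q'') (tensorTwist M' M'')).presheaf.map i).hom
      (AddMonoidHom.finsetSum_apply _ _ s)).symm)
    refine Eq.trans (Finset.sum_congr rfl fun j _ => ?_) (map_sum _ _ _).symm
    exact pathToAlg_map (M := tensorTwist M' M'') (p.left Q'' j) i s
  · refine Eq.trans ?_ (AddMonoidHom.finsetSum_apply _ _ _).symm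
    refine (congrArg ((leftHom M' M'').app U) (toSheafify_pathToAlg p U x)).trans ?_
    refine (congrArg ((leftHom M' M'').app U) (SheafRep.toPathAlgebra_app U _).symm).trans ?_
    refine (SheafRep.desc_toPathAlgebra _ U _).trans ?_
    refine (lift_left_tensorMap _ p x).trans (Finset.sum_congr rfl fun j _ => ?_)
    exact (toSheafify_pathToAlg (M := tensorTwist M' M'') (p.left Q'' j) U x).symm

lemma rightHom_pathToAlg (q : Q''.Path) (U : (Opens X)ᵒᵖ) (s : (pathSheaf Q'' M'' q).obj.obj U) :
    (rightHom M' M'').app U (((pathToAlg Q'' M'' q).app U).hom s) =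
      ∑ i, ((pathToAlg (Q'.tensor Q'') (tensorTwist M' M'') (q.right Q' i)).app U).hom s := by
  refine (pathSheaf_hom_ext (C := pathAlgebra (Q'.tensor Q'') (tensorTwist M' M'')) q
    (fun U => ((rightHom M' M'').app U).toRingHom.toAddMonoidHom.comp
      ((pathToAlg Q'' M'' q).app U).hom)
    (fun U => ∑ i, ((pathToAlg (Q'.tensor Q'') (tensorTwist M' M'') (q.right Q' i)).app U).hom)
    (fun U V i s => ?_) (fun U V i s => ?_) (fun U x => ?_) U s).trans
    (AddMonoidHom.finsetSum_apply _ _ s)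
  · exact (congrArg ((rightHom M' M'').app V) (pathToAlg_map q i s)).trans
      ((rightHom M' M'').app_map i _)
  · refine (AddMonoidHom.finsetSum_apply _ _ _).trans (Eq.trans ?_ (congrArg
      ((pathAlgebra (Q'.tensor Q'') (tensorTwist M' M'')).presheaf.map i).hom
      (AddMonoidHom.finsetSum_apply _ _ s)).symm)
    refine Eq.trans (Finset.sum_congr rfl fun j _ => ?_) (map_sum _ _ _).symm
    exact pathToAlg_map (M := tensorTwist M' M'') (q.right Q' j) i s
  · refine Eq.trans ?_ (AddMonoidHom.finsetSum_apply _ _ _).symm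
    refine (congrArg ((rightHom M' M'').app U) (toSheafify_pathToAlg q U x)).trans ?_
    refine (congrArg ((rightHom M' M'').app U) (SheafRep.toPathAlgebra_app U _).symm).trans ?_
    refine (SheafRep.desc_toPathAlgebra _ U _).trans ?_
    refine (lift_right_tensorMap _ q x).trans (Finset.sum_congr rfl fun j _ => ?_)
    exact (toSheafify_pathToAlg (M := tensorTwist M' M'') (q.right Q' j) U x).symm

/-- Identifies the generators of `I'` as the images of the relations in `R'`, which turns killing
`I'` into a condition on morphisms out of the path algebra of `Q'`. -/
lemma leftHom_toSection (r : Relation Q' M') :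
    (leftHom M' M'').app (op ⊤) r.toSection = ∑ j : Q''.V, leftSection M' M'' r j := by
  unfold Relation.toSection leftSection
  rw [map_sum, Finset.sum_comm]
  exact Finset.sum_congr rfl fun p _ => leftHom_pathToAlg p _ _

lemma rightHom_toSection (r : Relation Q'' M'') :
    (rightHom M' M'').app (op ⊤) r.toSection = ∑ i : Q'.V, rightSection M' M'' i r := by
  unfold Relation.toSection rightSection
  rw [map_sum, Finset.sum_comm]
  exact Finset.sum_congr rfl fun p _ => rightHom_pathToAlg p _ _

/-- The family of restrictions of a set of global sections. -/
def restrictions (A : AlgPresheaf X) (S : Set (A.presheaf.obj (op ⊤))) (U : (Opens X)ᵒᵖ) :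
    Set (A.presheaf.obj U) :=
  {s | ∃ t ∈ S, s = (A.presheaf.map (homOfLE le_top).op).hom t}

lemma AlgPresheaf.Hom.kills_restrictions {A C : AlgPresheaf X} (f : AlgPresheaf.Hom A C)
    (S : Set (A.presheaf.obj (op ⊤))) :
    f.Kills (restrictions A S) ↔ ∀ t ∈ S, f.app (op ⊤) t = 0 := by
  refine ⟨fun h t ht => h (op ⊤) t ⟨t, ht, ?_⟩, ?_⟩
  · exact (ConcreteCategory.congr_hom (A.presheaf.map_id (op ⊤)) t).symm
  · rintro h U _ ⟨t, ht, rfl⟩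
    rw [f.app_map, h t ht, map_zero]

variable (M' M'') in
/-- The commutators generating the commutativity ideal. -/
def commutators (U : (Opens X)ᵒᵖ) :
    Set ((pathAlgebra (Q'.tensor Q'') (tensorTwist M' M'')).presheaf.obj U) :=
  {s | ∃ (α : Q'.E) (β : Q''.E) (m' : Sec (M' α) U) (m'' : Sec (M'' β) U),
    s = arrowSection (Q'.tensor Q'') (tensorTwist M' M'') (Sum.inr (Q'.h α, β)) m'' *
          arrowSection (Q'.tensor Q'') (tensorTwist M' M'') (Sum.inl (α, Q''.t β)) m' -
        arrowSection (Q'.tensor Q'') (tensorTwist M' M'') (Sum.inl (α, Q''.h β)) m' *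
          arrowSection (Q'.tensor Q'') (tensorTwist M' M'') (Sum.inr (Q'.t α, β)) m''}

/-- The arrow sections are by definition the values of the universal representation, so killing the
differences is the commutation relation for its image. -/
lemma kills_commutators {C : AlgPresheaf X} (f : AlgPresheaf.Hom
      (pathAlgebra (Q'.tensor Q'') (tensorTwist M' M'')).toAlgPresheaf C) :
    f.Kills (commutators M' M'') ↔
      ((SheafRep.univ (Q'.tensor Q'') (tensorTwist M' M'')).push f).IsComm := by
  have key (U : (Opens X)ᵒᵖ)
      (x y z w : (pathAlgebra (Q'.tensor Q'') (tensorTwist M' M'')).presheaf.obj U) :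
      f.app U (x * y - z * w) = 0 ↔ f.app U x * f.app U y = f.app U z * f.app U w := by
    rw [map_sub, map_mul, map_mul, sub_eq_zero]
  constructor
  · intro h U α β m n
    exact (key U _ _ _ _).1 (h U _ ⟨α, β, m, n, rfl⟩)
  · rintro h U _ ⟨α, β, m, n, rfl⟩
    exact (key U _ _ _ _).2 (h U α β m n)

/-- The generators of the ideal of relations of the tensor quiver. -/
def tensorRelations (R' : Set (Relation Q' M')) (R'' : Set (Relation Q'' M''))
    (U : (Opens X)ᵒᵖ) :
    Set ((pathAlgebra (Q'.tensor Q'') (tensorTwist M' M'')).presheaf.obj U) :=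
  commutators M' M'' U ∪
    (restrictions (pathAlgebra (Q'.tensor Q'') (tensorTwist M' M'')).toAlgPresheaf
      ((fun r => ∑ j : Q''.V, leftSection M' M'' r j) '' R') U ∪
    restrictions (pathAlgebra (Q'.tensor Q'') (tensorTwist M' M'')).toAlgPresheaf
      ((fun r => ∑ i : Q'.V, rightSection M' M'' i r) '' R'') U)

/-- Splits the condition on the tensor quiver into the data of a morphism out of a tensor product:
commutation, and one condition for each factor. -/
lemma kills_tensorRelations {C : AlgSheaf X} (f : AlgPresheaf.Hom
      (pathAlgebra (Q'.tensor Q'') (tensorTwist M' M'')).toAlgPresheaf C.toAlgPresheaf)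
    (R' : Set (Relation Q' M')) (R'' : Set (Relation Q'' M'')) :
    f.Kills (tensorRelations R' R'') ↔
      ((SheafRep.univ (Q'.tensor Q'') (tensorTwist M' M'')).push f).IsComm ∧
      ((leftHom M' M'').comp f).Kills (restrictions _ (Relation.toSection '' R')) ∧
      ((rightHom M' M'').comp f).Kills (restrictions _ (Relation.toSection '' R'')) := by
  rw [← kills_commutators, AlgPresheaf.Hom.kills_restrictions,
    AlgPresheaf.Hom.kills_restrictions]
  simp only [Set.forall_mem_image, AlgPresheaf.Hom.comp_app, leftHom_toSection,
    rightHom_toSection]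
  have hl := f.kills_restrictions ((fun r => ∑ j : Q''.V, leftSection M' M'' r j) '' R')
  have hr := f.kills_restrictions ((fun r => ∑ i : Q'.V, rightSection M' M'' i r) '' R'')
  rw [Set.forall_mem_image] at hl hr
  rw [← hl, ← hr]
  exact ⟨fun h => ⟨fun U s hs => h U s (.inl hs), fun U s hs => h U s (.inr (.inl hs)),
    fun U s hs => h U s (.inr (.inr hs))⟩, fun h U s hs => hs.elim (h.1 U s)
      fun hs => hs.elim (h.2.1 U s) (h.2.2 U s)⟩

/-- The universal properties of `B` and of `A' ⊗ A''` yield morphisms in both directions. Working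
with arbitrary presentations covers the cases with and without relations together. -/
theorem isIsomorphic_tensor_of_presents (R' : Set (Relation Q' M')) (R'' : Set (Relation Q'' M''))
    {A' A'' B : AlgSheaf X}
    {π' : AlgPresheaf.Hom (pathAlgebra Q' M').toAlgPresheaf A'.toAlgPresheaf}
    (h' : Presents π' (restrictions _ (Relation.toSection '' R')))
    {π'' : AlgPresheaf.Hom (pathAlgebra Q'' M'').toAlgPresheaf A''.toAlgPresheaf}
    (h'' : Presents π'' (restrictions _ (Relation.toSection '' R'')))
    {π : AlgPresheaf.Hom (pathAlgebra (Q'.tensor Q'') (tensorTwist M' M'')).toAlgPresheaf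
      B.toAlgPresheaf}
    (h : Presents π (tensorRelations R' R'')) : B.IsIsomorphic (A'.tensor A'') := by
  -- The two factors commute inside `A' ⊗ A''`, so their universal representations combine into one
  -- of the tensor quiver.
  have hc := SheafRep.commutes_of_commute ((SheafRep.univ Q' M').push π')
    ((SheafRep.univ Q'' M'').push π'') _ _ (AlgSheaf.commute_incl (A := A') (B := A''))
  rw [← SheafRep.push_comp, ← SheafRep.push_comp] at hc
  have hleft {C : AlgSheaf X} (f : AlgPresheaf.Hom
      (pathAlgebra (Q'.tensor Q'') (tensorTwist M' M'')).toAlgPresheaf C.toAlgPresheaf) :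
      (leftHom M' M'').comp f = SheafRep.desc
        ((SheafRep.univ (Q'.tensor Q'') (tensorTwist M' M'')).push f).left := by
    rw [SheafRep.left_push, leftHom, SheafRep.desc_comp]
  have hright {C : AlgSheaf X} (f : AlgPresheaf.Hom
      (pathAlgebra (Q'.tensor Q'') (tensorTwist M' M'')).toAlgPresheaf C.toAlgPresheaf) :
      (rightHom M' M'').comp f = SheafRep.desc
        ((SheafRep.univ (Q'.tensor Q'') (tensorTwist M' M'')).push f).right := by
    rw [SheafRep.right_push, rightHom, SheafRep.desc_comp]
  -- After the rewriting below, this morphism restricts along `leftHom` to `π'` followed by the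
  -- inclusion of `A'`. It therefore kills the relations of `Q'`; `hr` is the analogue for `Q''`.
  have hl := hleft (SheafRep.tensor hc).desc
  have hr := hright (SheafRep.tensor hc).desc
  rw [SheafRep.univ_push_desc, SheafRep.left_tensor, SheafRep.desc_univ_push] at hl
  rw [SheafRep.univ_push_desc, SheafRep.right_tensor, SheafRep.desc_univ_push] at hr
  obtain ⟨φ, hφ⟩ := h.desc (A'.tensor A'') (SheafRep.tensor hc).desc (by
    rw [kills_tensorRelations, SheafRep.univ_push_desc, hl, hr]
    refine ⟨SheafRep.isComm_tensor hc, fun U s hs => ?_, fun U s hs => ?_⟩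
    · rw [AlgPresheaf.Hom.comp_app, h'.kills U s hs, map_zero]
    · rw [AlgPresheaf.Hom.comp_app, h''.kills U s hs, map_zero])
  obtain ⟨hcomm, hk', hk''⟩ := (kills_tensorRelations π R' R'').1 h.kills
  obtain ⟨f', hf'⟩ := h'.desc B _ hk'
  obtain ⟨f'', hf''⟩ := h''.desc B _ hk''
  -- Local surjectivity of `π'` and `π''` moves the test to the two path algebras, whose images in
  -- `B` commute because `π` kills the commutators.
  have hff : ∀ U a b, Commute (f'.app U a) (f''.app U b) := by
    refine h'.locSurj.commute f' f'' fun U a b => Commute.symm ?_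
    refine h''.locSurj.commute f'' (π'.comp f') (fun U b a => Commute.symm ?_) U b a
    rw [hf', ← AlgPresheaf.Hom.comp_app, hf'', hleft, hright]
    exact (SheafRep.commutes_left_right hcomm).desc U a b
  obtain ⟨ψ, hψ', hψ''⟩ := AlgSheaf.tensor_desc f' f'' hff
  -- For the endomorphism of `B`, `π` is cancelled and representations are compared through their
  -- left and right parts. For that of the tensor product, the two inclusions are treated separately
  -- and `π'`, `π''` are cancelled.
  refine AlgSheaf.isIsomorphic_of_hom φ ψ (h.locSurj.epi (SheafRep.hom_ext ?_))
    (AlgSheaf.tensor_ext (h'.locSurj.epi ?_) (h''.locSurj.epi ?_))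
  · rw [← AlgPresheaf.Hom.comp_assoc, hφ, SheafRep.push_comp, SheafRep.univ_push_desc,
      AlgPresheaf.Hom.comp_id]
    refine SheafRep.ext_left_right ((SheafRep.isComm_tensor hc).push ψ) hcomm ?_ ?_
    · rw [SheafRep.left_push, SheafRep.left_tensor, ← SheafRep.push_comp,
        AlgPresheaf.Hom.comp_assoc, hψ', hf', hleft, SheafRep.univ_push_desc]
    · rw [SheafRep.right_push, SheafRep.right_tensor, ← SheafRep.push_comp,
        AlgPresheaf.Hom.comp_assoc, hψ'', hf'', hright, SheafRep.univ_push_desc]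
  · rw [← AlgPresheaf.Hom.comp_assoc (A'.inclLeft A''), hψ', ← AlgPresheaf.Hom.comp_assoc, hf',
      AlgPresheaf.Hom.comp_assoc, hφ, hl, AlgPresheaf.Hom.comp_id]
  · rw [← AlgPresheaf.Hom.comp_assoc (A'.inclRight A''), hψ'', ← AlgPresheaf.Hom.comp_assoc, hf'',
      AlgPresheaf.Hom.comp_assoc, hφ, hr, AlgPresheaf.Hom.comp_id]

lemma IdealPresheaf.le_sheafify {A : AlgSheaf X} (I : IdealPresheaf A.toAlgPresheaf)
    (U : (Opens X)ᵒᵖ) : I.ideal U ≤ I.sheafify.ideal U := fun s hs =>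
  IdealPresheaf.mem_sheafify.2 fun _ hx => ⟨U, 𝟙 U, hx, by
    rw [A.presheaf.map_id]; exact hs⟩

lemma IdealPresheaf.subset_span (A : AlgPresheaf X)
    (S : ∀ U : (Opens X)ᵒᵖ, Set (A.presheaf.obj U)) (U : (Opens X)ᵒᵖ) :
    S U ⊆ (IdealPresheaf.span A S).ideal U := fun s hs =>
  TwoSidedIdeal.subset_span ⟨U, 𝟙 U, s, hs, by rw [A.presheaf.map_id]; rfl⟩

/-- The quotient by the ideal sheaf generated by a family of local sections. -/
lemma presents_sheafify_span (A : AlgSheaf X)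
    (S : ∀ U : (Opens X)ᵒᵖ, Set (A.presheaf.obj U)) :
    Presents (A.toQuotient (IdealPresheaf.span A.toAlgPresheaf S).sheafify) S :=
  presents_quotient A _
    (fun U _ hs => IdealPresheaf.le_sheafify _ U (IdealPresheaf.subset_span _ S U hs))
    fun _ _ hf => AlgPresheaf.Hom.kills_sheafify (AlgPresheaf.Hom.kills_span hf)

/-- A morphism to a sheaf that kills the generators kills each sheafified span, then their presheaf
sum, then the sheafification of that sum. -/
lemma presents_tensorRelations (R' : Set (Relation Q' M')) (R'' : Set (Relation Q'' M'')) :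
    Presents (AlgSheaf.toQuotient _ (((commIdeal M' M'').add (leftIdeal M' M'' R')).add
      (rightIdeal M' M'' R'')).sheafify) (tensorRelations R' R'') := by
  refine presents_quotient _ _ (fun U s hs => IdealPresheaf.le_sheafify _ U ?_) fun C f hf =>
    AlgPresheaf.Hom.kills_sheafify (AlgPresheaf.Hom.kills_add (AlgPresheaf.Hom.kills_add ?_ ?_) ?_)
  · rcases hs with hs | hs | hs
    · exact TwoSidedIdeal.mem_sup_left (TwoSidedIdeal.mem_sup_left
        (IdealPresheaf.le_sheafify _ U (IdealPresheaf.subset_span _ _ U hs)))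
    · exact TwoSidedIdeal.mem_sup_left (TwoSidedIdeal.mem_sup_right
        (IdealPresheaf.le_sheafify _ U (IdealPresheaf.subset_span _ _ U hs)))
    · exact TwoSidedIdeal.mem_sup_right
        (IdealPresheaf.le_sheafify _ U (IdealPresheaf.subset_span _ _ U hs))
  · exact AlgPresheaf.Hom.kills_sheafify (AlgPresheaf.Hom.kills_span
      fun U s hs => hf U s (.inl hs))
  · exact AlgPresheaf.Hom.kills_sheafify (AlgPresheaf.Hom.kills_span
      fun U s hs => hf U s (.inr (.inl hs)))
  · exact AlgPresheaf.Hom.kills_sheafify (AlgPresheaf.Hom.kills_span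
      fun U s hs => hf U s (.inr (.inr hs)))

lemma restrictions_empty (A : AlgPresheaf X) (U : (Opens X)ᵒᵖ) : restrictions A ∅ U = ∅ := by
  simp [restrictions]

lemma tensorRelations_empty :
    tensorRelations (∅ : Set (Relation Q' M')) (∅ : Set (Relation Q'' M'')) =
      commutators M' M'' := by
  funext U
  simp [tensorRelations, restrictions_empty]

end Main
end TwistedPathAlgebra
end

open TwistedPathAlgebra
theorem mainTheorem4 (X : RingedSpace.{u, u}) (Q' Q'' : FinQuiver.{u})
    (M' : Q'.E → SheafOfModules.{u} (structureSheaf X))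
    (M'' : Q''.E → SheafOfModules.{u} (structureSheaf X)) :
    -- without relations
    ((pathAlgebra (Q'.tensor Q'') (tensorTwist M' M'')).quotient (commIdeal M' M'')).IsIsomorphic
        ((pathAlgebra Q' M').tensor (pathAlgebra Q'' M'')) ∧
    -- with relations
    ∀ (R' : Set (Relation Q' M')) (R'' : Set (Relation Q'' M'')),
      ((pathAlgebra (Q'.tensor Q'') (tensorTwist M' M'')).quotient
          (((commIdeal M' M'').add (leftIdeal M' M'' R')).add
            (rightIdeal M' M'' R'')).sheafify).IsIsomorphic
        (((pathAlgebra Q' M').quotient (relationIdeal R')).tensor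
          ((pathAlgebra Q'' M'').quotient (relationIdeal R''))) := by
  refine ⟨?_, fun R' R'' => isIsomorphic_tensor_of_presents R' R'' (presents_sheafify_span _ _)
    (presents_sheafify_span _ _) (presents_tensorRelations R' R'')⟩
  -- With no relations only the commutators remain, and each factor is presented by its identity
  -- morphism.
  have h : Presents (AlgSheaf.toQuotient _ (commIdeal M' M'')) (tensorRelations ∅ ∅) := by
    rw [tensorRelations_empty]
    exact presents_sheafify_span _ _
  refine isIsomorphic_tensor_of_presents ∅ ∅ (presents_id _ fun U => ?_)
    (presents_id _ fun U => ?_) h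
  · rw [Set.image_empty, restrictions_empty]
  · rw [Set.image_empty, restrictions_empty]
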